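/- **Setting.** Let $S,A$ be finite nonempty sets of states and actions, $R\subset[0,\infty)$ a finite set of rewards, $r_{\max}=\max R$, $\gamma\in(0,1)$, and for every $(s,a)\in S\times A$ let $\nu_{s,a}$ be a probability distribution on $R$ and $p_{s,a}$ one on $S$. For $Q:S\times A\to\mathbb R$ put $v(Q)(s)=\max_{b\in A}Q(s,b)$ and $\|Q\|_\infty=\max_{s,a}|Q(s,a)|$. For $\delta>0$ the distributionally robust Bellman operator is $$\mathcal T_\delta(Q)(s,a)=\inf\Big\{\mathbb E_{r\sim\nu}[r]+\gamma\,\mathbb E_{s'\sim p}[v(Q)(s')]\;:\;D_{\mathrm{KL}}(\nu\|\nu_{s,a})\le\delta,\ D_{\mathrm{KL}}(p\|p_{s,a})\le\delta\Big\}.$$ The minimal support probability $p_\wedge$ is the smallest of all positive values $\nu_{s,a}(r)$, $p_{s,a}(s')$ ($s,s'\in S$, $a\in A$, $r\in R$). **Estimator.** For a probability distribution $\mu$ on a finite set $Y$ and $u:Y\to\mathbb R$ let $F_\delta(\mu,u)=\sup_{\alpha\ge0}\{-\alpha\log\mathbb E_{y\sim\mu}[e^{-u(y)/\alpha}]-\alpha\delta\}$,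 where the value at $\alpha=0$ is the limit, $\min\{u(y):\mu(y)>0\}$. For a sequence $y=(y_1,y_2,\dots)$ in $Y$ let $$\Delta_n(u,y)=F_\delta(\mu_{2^{n+1}},u)-\tfrac12F_\delta(\mu^E_{2^n},u)-\tfrac12F_\delta(\mu^O_{2^n},u),$$ where $\mu_{2^{n+1}},\mu^E_{2^n},\mu^O_{2^n}$ are the empirical distributions of all, of the even-indexed and of the odd-indexed points among $y_1,\dots,y_{2^{n+1}}$. Let $g\in(0,1)$ and $p_n=g(1-g)^n$, $n\ge0$. Let $N_1,N_2$ be independent with $\mathbb P(N_j=n)=p_n$, and, independently of them and of each other, let $r_{s,a,i}\sim\nu_{s,a}$ and $s'_{s,a,i}\sim p_{s,a}$ for $(s,a)\in S\times A$, $i\ge1$. The MLMC-DR estimator is $$\widehat{\mathcal T}_\delta(Q)(s,a)=r_{s,a,1}+\frac{\Delta_{N_1}(\mathrm{id},r_{s,a,\cdot})}{p_{N_1}}+\gamma\Big(v(Q)(s'_{s,a,1})+\frac{\Delta_{N_2}(v(Q),s'_{s,a,\cdot})}{p_{N_2}}\Big),$$ with the levels $N_1,N_2$ common to all pairs $(s,a)$.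 Put $W(Q)=\widehat{\mathcal T}_\delta(Q)-\mathcal T_\delta(Q)$ and $$\tilde l=\Big(3+\max\{\log(|S||A||R|),\log(|S|^2|A|)\}\Big)^2\Big(\log\frac{11}{p_\wedge}\Big)^2\frac{4(1-g)}{g(3-4g)}.$$ **Proposition.** There is an absolute constant $c>0$ (independent of $S,A,R,\nu,p,\gamma,\delta,g,Q$) such that, whenever $\delta>0$, $1-e^{-\delta}\le\frac12p_\wedge$ and $g\in(0,3/4)$, for every fixed $Q:S\times A\to\mathbb R$ the variable $\|W(Q)\|_\infty^2$ is integrable and $$\mathbb E\|W(Q)\|_\infty^2\le\frac{c\,\tilde l}{\delta^4p_\wedge^6}\big(r_{\max}^2+\gamma^2\|Q\|_\infty^2\big).$$ If instead the pair of levels $(N_1,N_2)$ is drawn independently for each pair $(s,a)$, then $\|W(Q)\|_\infty^2$ is integrable and the same bound holds with $c$ replaced by $c\,|S||A|$. -/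

import Mathlib

open MeasureTheory ProbabilityTheory

noncomputable section

/-- A finite (nominal) Markov decision process: a finite set `R` of nonnegative rewards, reward
distributions `ν s a` on `R`, transition distributions `p s a` on `S`, and a discount factor
`γ ∈ (0, 1)`. The state space `S` and the action space `A` are finite in all that follows. -/
structure NominalMDP (S A : Type*) where
  R : Finset ℝ
  R_nonneg : ∀ r ∈ R, 0 ≤ r
  ν : S → A → PMF R
  p : S → A → PMF S
  γ : ℝ
  γ_pos : 0 < γ
  γ_lt_one : γ < 1

/-- The KL uncertainty set of radius `δ` centered at the distribution `q`. -/
def klBall {Y : Type*} [MeasurableSpace Y] (δ : ℝ) (q : PMF Y) : Set (PMF Y) :=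
  {q' | InformationTheory.klDiv q'.toMeasure q.toMeasure ≤ ENNReal.ofReal δ}

/-- The expectation of `u` under the distribution `q` on a finite set. -/
def expect {Y : Type*} [Fintype Y] (q : PMF Y) (u : Y → ℝ) : ℝ :=
  ∑ y, (q y).toReal * u y

/-- `v(Q)(s) = max_b Q(s, b)`. -/
def greedyValue {S A : Type*} (Q : S × A → ℝ) (s : S) : ℝ :=
  ⨆ b : A, Q (s, b)

/-- The dual objective `f(μ, u, α) = -α log μ[exp(-u/α)] - αδ` for a weight function `μ` on a
finite set, with its limit `ess inf_μ u` as value at `α = 0`. -/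
def dualObjective {Y : Type*} [Fintype Y] (δ : ℝ) (μ u : Y → ℝ) (α : ℝ) : ℝ :=
  if α = 0 then ⨅ y : {y : Y // 0 < μ y}, u y
  else -α * Real.log (∑ y, μ y * Real.exp (-u y / α)) - α * δ

/-- `sup_{α ≥ 0} f(μ, u, α)`. -/
def dualValue {Y : Type*} [Fintype Y] (δ : ℝ) (μ u : Y → ℝ) : ℝ :=
  ⨆ α : Set.Ici (0 : ℝ), dualObjective δ μ u α

open Classical in
/-- The empirical distribution of the sample `x 0, …, x (m - 1)`. -/
def empirical {Y : Type*} (m : ℕ) (x : ℕ → Y) (y : Y) : ℝ :=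
  (((Finset.range m).filter fun i => x i = y).card : ℝ) / m

/-- The multilevel difference `Δ_n` computed from the first `2 ^ (n + 1)` terms of a sample.
The terms are `x 0, x 1, …`, so that the odd ones (the first, the third, …) are
`x 0, x 2, …` and the even ones are `x 1, x 3, …`. -/
def levelDifference {Y : Type*} [Fintype Y] (δ : ℝ) (u : Y → ℝ) (n : ℕ) (x : ℕ → Y) : ℝ :=
  dualValue δ (empirical (2 ^ (n + 1)) x) u
    - 1 / 2 * dualValue δ (empirical (2 ^ n) fun i => x (2 * i + 1)) u
    - 1 / 2 * dualValue δ (empirical (2 ^ n) fun i => x (2 * i)) u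

/-- The randomized multilevel estimator: the first sample point plus `Δ_n / p_n`, where
`p_n = g (1 - g) ^ n` and `n` is the (random) level. -/
def multilevelEstimate {Y : Type*} [Fintype Y] (δ g : ℝ) (u : Y → ℝ) (n : ℕ) (x : ℕ → Y) : ℝ :=
  u (x 0) + levelDifference δ u n x / (g * (1 - g) ^ n)

/-- All random variates used by the estimator: a pair of levels `(N₁, N₂)` for every state-action
pair, and for every state-action pair a sequence of rewards and a sequence of next states, of
which the first `2 ^ (N₁ + 1)`, respectively `2 ^ (N₂ + 1)`, are used. -/
abbrev Variates {S A : Type*} (M : NominalMDP S A) : Type _ :=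
  (S × A → ℕ × ℕ) × ((S × A × ℕ → M.R) × (S × A × ℕ → S))

/-- Levels `(N₁, N₂)` with independent `N₁, N₂ ∼ Geo(g)`, common to all state-action pairs. -/
def commonLevels (I : Type*) (g : unitInterval) : Measure (I → ℕ × ℕ) :=
  ((geometricMeasure g).prod (geometricMeasure g)).map fun n _ => n

/-- Levels `(N₁, N₂)` with independent `N₁, N₂ ∼ Geo(g)`, drawn independently for each
state-action pair. -/
def separateLevels (I : Type*) [Fintype I] (g : unitInterval) : Measure (I → ℕ × ℕ) :=
  Measure.pi fun _ => (geometricMeasure g).prod (geometricMeasure g)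

namespace NominalMDP

variable {S A : Type*} (M : NominalMDP S A)

/-- The maximum reward. -/
def rMax : ℝ := sSup (M.R : Set ℝ)

/-- The minimal support probability `p_∧`. -/
def minSupp : ℝ :=
  ⨅ x : S × A, min (⨅ r : (M.ν x.1 x.2).support, (M.ν x.1 x.2 r).toReal)
    (⨅ s : (M.p x.1 x.2).support, (M.p x.1 x.2 s).toReal)

/-- The distributionally robust Bellman operator `T_δ` for Q-functions. -/
def robustBellman [Fintype S] [MeasurableSpace S] (δ : ℝ) (Q : S × A → ℝ) (x : S × A) : ℝ :=
  sInf {t : ℝ | ∃ ν' ∈ klBall δ (M.ν x.1 x.2), ∃ p' ∈ klBall δ (M.p x.1 x.2),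
    t = expect ν' (fun r => (r : ℝ)) + M.γ * expect p' (greedyValue Q)}

/-- The MLMC-DR estimator of `T_δ(Q)`, as a function of the random variates. -/
def mlmcEstimator [Fintype S] (δ g : ℝ) (Q : S × A → ℝ) (ω : Variates M) (x : S × A) : ℝ :=
  multilevelEstimate δ g (fun r : M.R => (r : ℝ)) (ω.1 x).1 (fun i => ω.2.1 (x.1, x.2, i))
    + M.γ * multilevelEstimate δ g (greedyValue Q) (ω.1 x).2 (fun i => ω.2.2 (x.1, x.2, i))

/-- The noise `W(Q)`: the MLMC-DR estimator minus `T_δ(Q)`. -/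
def noise [Fintype S] [MeasurableSpace S] (δ g : ℝ) (Q : S × A → ℝ) (ω : Variates M) :
    S × A → ℝ :=
  fun x => M.mlmcEstimator δ g Q ω x - M.robustBellman δ Q x

/-- The law of the random variates when the levels have law `L`: the levels, all rewards
`r_i ∼ ν_{s,a}` and all next states `s'_i ∼ p_{s,a}` are independent. -/
def variatesLaw [MeasurableSpace S] (L : Measure (S × A → ℕ × ℕ)) : Measure (Variates M) :=
  L.prod ((Measure.infinitePi fun k : S × A × ℕ => (M.ν k.1 k.2.1).toMeasure).prod
    (Measure.infinitePi fun k : S × A × ℕ => (M.p k.1 k.2.1).toMeasure))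

/-- The logarithmic factor `l̃`. -/
def logFactor [Fintype S] [Fintype A] (g : ℝ) : ℝ :=
  (3 + max (Real.log (Fintype.card S * Fintype.card A * M.R.card))
      (Real.log ((Fintype.card S : ℝ) ^ 2 * Fintype.card A))) ^ 2
    * Real.log (11 / M.minSupp) ^ 2 * (4 * (1 - g) / (g * (3 - 4 * g)))

end NominalMDP

end

/-!
The bound is a crude second-moment estimate: neither unbiasedness of the estimator nor strong
duality is needed, only `|T_δ(Q)| ≤ r_max + γ ‖Q‖` and control of the multilevel differences `Δ_n`.

*Deterministic part.* The two half-sample empirical distributions `E`, `O` have the full empirical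
distribution `μ` as their midpoint, so `Δ_n` is a midpoint defect of the functional
`F(μ) = sup_α f(μ, u, α)`. Let `l = 1 / α`, and let the tilt `q ∝ μ exp (-l u)` have relative
entropy `K(l)` with respect to `μ`. The hypothesis `1 - exp (-δ) ≤ p_∧ / 2` keeps `δ` away from the
saturation value of `K`, so `K(l₀) = δ` has a solution at which even the largest value of `u` keeps
tilted mass of order `p_∧` (`exists_tiltEntropy_eq`). For a weight `μ'` within relative distance
`ε` of `μ`, the entropy of its tilt at `l₀` differs from `δ` by `O(ε ρ)`, with
`ρ = l₀ (max u - min u)` (`abs_tiltEntropy_sub_le`). Writing `s = l / l₀ - 1`, one has exactly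
`f(μ', u, 1 / l) - f(μ', u, 1 / l₀) = (1 / l) (s (δ - K'(l₀)) - log E_q' exp (s X))`, where
`X` is `-l₀ u` centered under the tilt `q'` of `μ'`. The logarithmic moment generating function is
at least of order `p_∧ min (s² ρ², |s| ρ)`, so the best `α` for `μ'` gains at most
`O(α ε² / p_∧)` over `1 / l₀` (`dualObjective_inv_le_add`). At the common dual variable `1 / l₀`
the midpoint defect is `O(ε² / l₀)` (`dualObjective_midpoint`). Since only `α ≤ 2 ‖u‖ / δ` matters,
`|Δ_n| ≤ C ‖u‖ d² / (δ p_∧³)`, where `d` is the largest deviation of `E` and `O` from the sampling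
distribution (`abs_midpoint_dualValue_le`).

*Probabilistic part.* By Hoeffding's lemma each deviation is sub-Gaussian at scale `2 ^ (-n / 2)`,
and the pointwise inequality `pow_four_le_add_exp` turns this into
`E max d⁴ ≤ C (1 + log #)² / 4 ^ n` (`integral_quarticBound_le`). Averaging `Δ_n² / p_n²` over
`n` with weights `p_n` gives the series `∑ 1 / (p_n 4 ^ n) = 4 (1 - g) / (g (3 - 4 g))`, which
converges because `g < 3 / 4` (`integral_randomLevel_le`). One random variable `noiseBound`,
depending on the levels of a single state-action pair and on all samples, dominates the squared
noise at that pair. With common levels it dominates the squared norm, and with separate levels its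
sum over all pairs does.
-/

noncomputable section

/-! ### Growth of logarithmic moment generating functions -/

lemma sq_div_four_le_exp_sub {v z : ℝ} (hv0 : 0 ≤ v) (hv1 : v ≤ 1) (hz : v ≤ |z|) :
    v ^ 2 / 4 ≤ Real.exp z - 1 - z := by
  have hvz : v ^ 2 ≤ z ^ 2 := by rw [← sq_abs z]; gcongr
  rcases le_total 0 z with h | h
  · have := Real.quadratic_le_exp_of_nonneg h
    nlinarith
  rcases le_total (-2) z with h2 | h2
  · have h3 : 1 + z / 2 ≤ Real.exp (z / 2) := by linarith [Real.add_one_le_exp (z / 2)]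
    have h4 : Real.exp z = Real.exp (z / 2) ^ 2 := by
      rw [← Real.exp_nat_mul]; congr 1; push_cast; ring
    have h5 : (1 + z / 2) ^ 2 ≤ Real.exp (z / 2) ^ 2 := by gcongr; linarith
    rw [h4]; nlinarith
  · have := Real.exp_pos z
    nlinarith

section Mgf
variable {Y : Type*} [Fintype Y]

lemma one_add_le_sum_mul_exp {q X : Y → ℝ} (hq : ∀ y, 0 ≤ q y) (hq1 : ∑ y, q y = 1)
    (hX : ∑ y, q y * X y = 0) {η s v : ℝ} {y : Y} (hη : η ≤ q y) (hv0 : 0 ≤ v)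
    (hv1 : v ≤ 1) (hv : v ≤ |s * X y|) :
    1 + η * v ^ 2 / 4 ≤ ∑ y, q y * Real.exp (s * X y) := by
  have h1 : ∑ y, q y * (Real.exp (s * X y) - 1 - s * X y)
      = ∑ y, q y * Real.exp (s * X y) - 1 := by
    have : ∀ y, q y * (Real.exp (s * X y) - 1 - s * X y)
        = q y * Real.exp (s * X y) - q y - s * (q y * X y) := fun y => by ring
    simp_rw [this, Finset.sum_sub_distrib, ← Finset.mul_sum, hX, hq1]
    ring
  have h2 : q y * (Real.exp (s * X y) - 1 - s * X y)
      ≤ ∑ y, q y * (Real.exp (s * X y) - 1 - s * X y) :=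
    Finset.single_le_sum (f := fun y => q y * (Real.exp (s * X y) - 1 - s * X y))
      (fun z _ => mul_nonneg (hq z) (by linarith [Real.add_one_le_exp (s * X z)]))
      (Finset.mem_univ y)
  have h3 := sq_div_four_le_exp_sub hv0 hv1 hv
  have h4 : η * (v ^ 2 / 4) ≤ q y * (Real.exp (s * X y) - 1 - s * X y) := by
    gcongr
    · exact hq y
  linarith

lemma div_one_add_le_log {v : ℝ} (hv : 0 ≤ v) : v / (1 + v) ≤ Real.log (1 + v) := by
  have h := Real.one_sub_inv_le_log_of_pos (show 0 < 1 + v by linarith)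
  have : 1 - (1 + v)⁻¹ = v / (1 + v) := by field_simp; ring
  linarith

/-- The logarithmic moment generating function of a centered variable that takes two values at
distance `ρ` with mass at least `η` each dominates every line of slope `k ≤ ρ η / 10`, up to an
error quadratic in `k`. -/
lemma mul_sub_log_mgf_le {q X : Y → ℝ} (hq : ∀ y, 0 ≤ q y) (hq1 : ∑ y, q y = 1)
    (hX : ∑ y, q y * X y = 0) {a b : Y} {η ρ k : ℝ} (hη : 0 < η) (ha : η ≤ q a) (hb : η ≤ q b)
    (hρ : 0 < ρ) (hab : ρ ≤ X a - X b) (hk : 10 * k ≤ ρ * η) (s : ℝ) :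
    |s| * k - Real.log (∑ y, q y * Real.exp (s * X y)) ≤ 5 * k ^ 2 / (η * ρ ^ 2) := by
  obtain ⟨y, hηy, hy⟩ : ∃ y, η ≤ q y ∧ ρ / 2 ≤ |X y| := by
    by_cases h : ρ / 2 ≤ |X a|
    · exact ⟨a, ha, h⟩
    · refine ⟨b, hb, ?_⟩
      have := le_abs_self (X a)
      have := neg_abs_le (X b)
      linarith
  have hη1 : η ≤ 1 := hηy.trans (by
    rw [← hq1]; exact Finset.single_le_sum (fun z _ => hq z) (Finset.mem_univ y))
  have hs := abs_nonneg s
  have hlog : ∀ v : ℝ, 0 ≤ v → v ≤ 1 → η * v ^ 2 / 5 ≤ Real.log (1 + η * v ^ 2 / 4) := by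
    intro v h0 h1
    have hx : 0 ≤ η * v ^ 2 / 4 := by positivity
    have hx1 : η * v ^ 2 / 4 ≤ 1 / 4 := by
      have : η * v ^ 2 ≤ 1 * 1 ^ 2 := by gcongr
      linarith
    refine le_trans ?_ (div_one_add_le_log hx)
    rw [le_div_iff₀ (by linarith)]
    nlinarith
  -- Quadratic growth for `|s| ρ ≤ 2`. Beyond that, Jensen's inequality for `x ↦ x ^ t` extends the
  -- bound at `|r| = 2 / ρ` linearly.
  rcases le_total (|s| * ρ) 2 with hsρ | hsρ
  · have h1 := one_add_le_sum_mul_exp (s := s) (v := |s| * ρ / 2) hq hq1 hX hηy (by positivity)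
      (by linarith) (by rw [abs_mul, mul_div_assoc]; gcongr)
    have h2 := hlog (|s| * ρ / 2) (by positivity) (by linarith)
    have h3 := Real.log_le_log (by positivity) h1
    have h4 : |s| * k ≤ η * (|s| * ρ / 2) ^ 2 / 5 + 5 * k ^ 2 / (η * ρ ^ 2) := by
      have : η * (|s| * ρ / 2) ^ 2 / 5 + 5 * k ^ 2 / (η * ρ ^ 2) - |s| * k
          = (η * ρ ^ 2 * |s| - 10 * k) ^ 2 / (20 * (η * ρ ^ 2)) := by
        field_simp; ring
      have : 0 ≤ (η * ρ ^ 2 * |s| - 10 * k) ^ 2 / (20 * (η * ρ ^ 2)) := by positivity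
      linarith
    linarith
  · have hs0 : 0 < |s| := by
      by_contra h
      have : |s| = 0 := le_antisymm (not_lt.1 h) hs
      rw [this] at hsρ; linarith
    set t := |s| * ρ / 2 with ht
    have ht1 : 1 ≤ t := by linarith
    set r := s / t with hr
    have hsr : s = t * r := by rw [hr]; field_simp
    have hr2 : |r| = 2 / ρ := by
      rw [hr, abs_div, abs_of_pos (show 0 < t by linarith), ht]; field_simp
    have h1 := one_add_le_sum_mul_exp (s := r) (v := 1) hq hq1 hX hηy zero_le_one le_rfl
      (by rw [abs_mul, hr2, div_mul_eq_mul_div, le_div_iff₀ hρ]; linarith)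
    have h2 := hlog 1 zero_le_one le_rfl
    have h3 := Real.rpow_arith_mean_le_arith_mean_rpow Finset.univ q
      (fun y => Real.exp (r * X y)) (fun y _ => hq y) hq1 (fun y _ => (Real.exp_pos _).le) ht1
    have h4 : ∀ y, Real.exp (r * X y) ^ t = Real.exp (s * X y) := by
      intro y; rw [← Real.exp_mul, hsr]; congr 1; ring
    simp_rw [h4] at h3
    have h0 : (0 : ℝ) < 1 + η * 1 ^ 2 / 4 := by positivity
    have h5 := Real.log_le_log (Real.rpow_pos_of_pos (lt_of_lt_of_le h0 h1) t) h3
    rw [Real.log_rpow (lt_of_lt_of_le h0 h1)] at h5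
    have h6 := Real.log_le_log h0 h1
    have h7 : t * (η / 5) ≤ Real.log (∑ y, q y * Real.exp (s * X y)) := by
      refine le_trans ?_ h5
      gcongr
      linarith
    have h8 : |s| * k ≤ t * (η / 5) := by rw [ht]; nlinarith
    have h9 : 0 ≤ 5 * k ^ 2 / (η * ρ ^ 2) := by positivity
    linarith

end Mgf

/-! ### Exponential tilts -/

section Tilt
variable {Y : Type*} [Fintype Y]

/-- The Laplace sum `μ[exp (-l u)]` of the weights `μ`. -/
def laplaceSum (μ u : Y → ℝ) (l : ℝ) : ℝ := ∑ y, μ y * Real.exp (-l * u y)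

/-- The exponential tilt of the weights `μ`, proportional to `μ exp (-l u)`. -/
def tilt (μ u : Y → ℝ) (l : ℝ) (y : Y) : ℝ := μ y * Real.exp (-l * u y) / laplaceSum μ u l

/-- The relative entropy of `tilt μ u l` with respect to `μ`. Substituting the density
`exp (-l u) / laplaceSum μ u l` into its definition gives the formula used here, in which no
logarithm of a vanishing weight occurs. -/
def tiltEntropy (μ u : Y → ℝ) (l : ℝ) : ℝ :=
  -l * ∑ y, tilt μ u l y * u y - Real.log (laplaceSum μ u l)

variable {μ u : Y → ℝ}

lemma exists_min_of_sum_eq_one (hμ1 : ∑ y, μ y = 1) (u : Y → ℝ) :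
    ∃ a, 0 < μ a ∧ ∀ y, 0 < μ y → u a ≤ u y := by
  classical
  obtain ⟨y, -, hy⟩ : ∃ y ∈ Finset.univ, 0 < μ y := by
    apply Finset.exists_lt_of_sum_lt (f := fun _ => (0 : ℝ))
    simp [hμ1]
  obtain ⟨a, ha, h⟩ := Finset.exists_min_image (Finset.univ.filter fun y => 0 < μ y) u
    ⟨y, by simpa using hy⟩
  exact ⟨a, by simpa using ha, fun y hy => h y (by simpa using hy)⟩

lemma laplaceSum_pos (hμ : ∀ y, 0 ≤ μ y) (hμ1 : ∑ y, μ y = 1) (u : Y → ℝ) (l : ℝ) :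
    0 < laplaceSum μ u l := by
  obtain ⟨y, hy, -⟩ := exists_min_of_sum_eq_one hμ1 u
  exact Finset.sum_pos' (fun z _ => mul_nonneg (hμ z) (Real.exp_pos _).le)
    ⟨y, Finset.mem_univ y, mul_pos hy (Real.exp_pos _)⟩

lemma tilt_nonneg (hμ : ∀ y, 0 ≤ μ y) (u : Y → ℝ) (l : ℝ) (y : Y) : 0 ≤ tilt μ u l y :=
  div_nonneg (mul_nonneg (hμ y) (Real.exp_pos _).le)
    (Finset.sum_nonneg fun z _ => mul_nonneg (hμ z) (Real.exp_pos _).le)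

lemma sum_tilt (hμ : ∀ y, 0 ≤ μ y) (hμ1 : ∑ y, μ y = 1) (u : Y → ℝ) (l : ℝ) :
    ∑ y, tilt μ u l y = 1 := by
  unfold tilt
  rw [← Finset.sum_div]
  exact div_self (laplaceSum_pos hμ hμ1 u l).ne'

/-- The Laplace sum at `l` is a centered moment generating function of the tilt at `l₀`. -/
lemma laplaceSum_eq (hμ : ∀ y, 0 ≤ μ y) (hμ1 : ∑ y, μ y = 1) {l₀ : ℝ} (hl₀ : 0 < l₀)
    (l m : ℝ) :
    laplaceSum μ u l = laplaceSum μ u l₀ * Real.exp (-(l - l₀) * m) *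
      ∑ y, tilt μ u l₀ y * Real.exp ((l / l₀ - 1) * (-l₀ * (u y - m))) := by
  rw [Finset.mul_sum]
  refine Finset.sum_congr rfl fun y _ => ?_
  have hZ := (laplaceSum_pos hμ hμ1 u l₀).ne'
  have : Real.exp (-l * u y) = Real.exp (-(l - l₀) * m) * (Real.exp (-l₀ * u y) *
      Real.exp ((l / l₀ - 1) * (-l₀ * (u y - m)))) := by
    rw [← Real.exp_add, ← Real.exp_add]
    congr 1
    field_simp
    ring
  rw [this, tilt]
  field_simp

lemma dualObjective_inv (δ : ℝ) (μ u : Y → ℝ) {l : ℝ} (hl : 0 < l) :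
    dualObjective δ μ u l⁻¹ = -(Real.log (laplaceSum μ u l) + δ) / l := by
  rw [dualObjective, if_neg (inv_ne_zero hl.ne')]
  have : ∑ y, μ y * Real.exp (-u y / l⁻¹) = laplaceSum μ u l := by
    refine Finset.sum_congr rfl fun y _ => ?_
    congr 2
    field_simp
  rw [this]
  field_simp
  ring

/-- If the tilt at `l₀` has entropy close to `δ`, then `1 / l₀` almost maximizes the dual
objective: the loss is quadratic in the entropy defect `k`, because the centered logarithmic moment
generating function of a nondegenerate variable grows quadratically near zero. -/
lemma dualObjective_inv_le_add (hμ : ∀ y, 0 ≤ μ y) (hμ1 : ∑ y, μ y = 1) {δ l₀ l η k : ℝ}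
    {a b : Y} (hl₀ : 0 < l₀) (hl : 0 < l) (hη : 0 < η) (ha : η ≤ tilt μ u l₀ a)
    (hb : η ≤ tilt μ u l₀ b) (hab : u a < u b) (hk : |tiltEntropy μ u l₀ - δ| ≤ k)
    (hk' : 10 * k ≤ l₀ * (u b - u a) * η) :
    dualObjective δ μ u l⁻¹ ≤ dualObjective δ μ u l₀⁻¹
      + 1 / l * (5 * k ^ 2 / (η * (l₀ * (u b - u a)) ^ 2)) := by
  set m := ∑ y, tilt μ u l₀ y * u y with hm
  set ψ := ∑ y, tilt μ u l₀ y * Real.exp ((l / l₀ - 1) * (-l₀ * (u y - m))) with hψ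
  have hq1 := sum_tilt hμ hμ1 u l₀
  have hX : ∑ y, tilt μ u l₀ y * (-l₀ * (u y - m)) = 0 := by
    have : ∀ y, tilt μ u l₀ y * (-l₀ * (u y - m))
        = -l₀ * (tilt μ u l₀ y * u y) + l₀ * m * tilt μ u l₀ y := fun y => by ring
    simp_rw [this, Finset.sum_add_distrib, ← Finset.mul_sum, hq1, ← hm]
    ring
  have key := mul_sub_log_mgf_le (tilt_nonneg hμ u l₀) hq1 hX hη ha hb
    (ρ := l₀ * (u b - u a)) (mul_pos hl₀ (by linarith)) (by linarith) hk' (l / l₀ - 1)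
  rw [← hψ] at key
  have hZ := laplaceSum_pos hμ hμ1 u l
  have hZ₀ := laplaceSum_pos hμ hμ1 u l₀
  have hE := laplaceSum_eq (u := u) hμ hμ1 hl₀ l m
  rw [← hψ] at hE
  have hψ0 : 0 < ψ := by
    rw [hE] at hZ
    exact (mul_pos_iff_of_pos_left (mul_pos hZ₀ (Real.exp_pos _))).1 hZ
  have hlog : Real.log (laplaceSum μ u l)
      = Real.log (laplaceSum μ u l₀) - (l - l₀) * m + Real.log ψ := by
    rw [hE, Real.log_mul (mul_pos hZ₀ (Real.exp_pos _)).ne' hψ0.ne',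
      Real.log_mul hZ₀.ne' (Real.exp_pos _).ne', Real.log_exp]
    ring
  have hK : tiltEntropy μ u l₀ = -l₀ * m - Real.log (laplaceSum μ u l₀) := rfl
  have h1 : (l / l₀ - 1) * (δ - tiltEntropy μ u l₀) ≤ |l / l₀ - 1| * k := by
    refine (le_abs_self _).trans ?_
    rw [abs_mul, abs_sub_comm δ]
    gcongr
  have h2 : dualObjective δ μ u l⁻¹ - dualObjective δ μ u l₀⁻¹
      = 1 / l * ((l / l₀ - 1) * (δ - tiltEntropy μ u l₀) - Real.log ψ) := by
    rw [dualObjective_inv _ _ _ hl, dualObjective_inv _ _ _ hl₀, hlog, hK]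
    field_simp
    ring
  have h3 : 1 / l * ((l / l₀ - 1) * (δ - tiltEntropy μ u l₀) - Real.log ψ)
      ≤ 1 / l * (5 * k ^ 2 / (η * (l₀ * (u b - u a)) ^ 2)) := by
    gcongr
    linarith
  linarith

/-- A lower bound on the entropy from the Donsker–Varadhan inequality, for a test function
supported at one point. -/
lemma le_tiltEntropy (hμ : ∀ y, 0 ≤ μ y) (hμ1 : ∑ y, μ y = 1) (l : ℝ) (b : Y) :
    -(tilt μ u l b * Real.log 8) - Real.log (1 - 7 / 8 * μ b) ≤ tiltEntropy μ u l := by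
  classical
  have hZ := laplaceSum_pos hμ hμ1 u l
  have hq1 := sum_tilt hμ hμ1 u l
  set f : Y → ℝ := fun y => if y = b then -Real.log 8 else 0 with hf
  have hJ := convexOn_exp.map_sum_le (t := Finset.univ) (w := tilt μ u l)
    (p := fun y => f y + l * u y) (fun y _ => tilt_nonneg hμ u l y) hq1 (fun _ _ => trivial)
  simp only [smul_eq_mul] at hJ
  have h1 : ∑ y, tilt μ u l y * (f y + l * u y)
      = -(tilt μ u l b * Real.log 8) + l * ∑ y, tilt μ u l y * u y := by
    simp only [mul_add, Finset.sum_add_distrib, hf, mul_ite, mul_zero, Finset.sum_ite_eq',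
      Finset.mem_univ, if_true, Finset.mul_sum]
    congr 1
    · ring
    · exact Finset.sum_congr rfl fun y _ => by ring
  have h2 : ∑ y, tilt μ u l y * Real.exp (f y + l * u y)
      = (1 - 7 / 8 * μ b) / laplaceSum μ u l := by
    have h3 : ∀ y, tilt μ u l y * Real.exp (f y + l * u y)
        = (μ y - if y = b then 7 / 8 * μ y else 0) / laplaceSum μ u l := by
      intro y
      have : Real.exp (-l * u y) * Real.exp (f y + l * u y) = Real.exp (f y) := by
        rw [← Real.exp_add]; congr 1; ring
      rw [tilt, div_mul_eq_mul_div, mul_assoc, this]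
      congr 1
      by_cases h : y = b
      · simp only [hf, h, if_true, Real.exp_neg, Real.exp_log (show (0 : ℝ) < 8 by norm_num)]
        ring
      · simp [hf, h]
    simp_rw [h3]
    rw [← Finset.sum_div, Finset.sum_sub_distrib, hμ1]
    simp
  rw [h1, h2] at hJ
  have hpos := (Real.exp_pos _).trans_le hJ
  have h4 := Real.log_le_log (Real.exp_pos _) hJ
  have h5 : 0 < 1 - 7 / 8 * μ b := by
    rcases (div_pos_iff.1 hpos) with h | h
    · exact h.1
    · linarith [h.2]
  rw [Real.log_exp, Real.log_div h5.ne' hZ.ne'] at h4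
  rw [tiltEntropy]
  linarith

/-- If the tilt has almost removed the mass of a point `b`, then its entropy exceeds `δ`. The
margin comes from the gap between `δ ≤ -log (1 - 2 μ b / 3)` and the entropy `-log (1 - μ b)` of
conditioning on the complement of `b`. -/
lemma lt_tiltEntropy (hμ : ∀ y, 0 ≤ μ y) (hμ1 : ∑ y, μ y = 1) {l δ : ℝ} {b : Y}
    (hb : 0 < μ b) (hδ : 1 - Real.exp (-δ) ≤ 2 / 3 * μ b) (ht : tilt μ u l b ≤ μ b / 20) :
    δ < tiltEntropy μ u l := by
  refine lt_of_lt_of_le ?_ (le_tiltEntropy hμ hμ1 l b)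
  have hb1 : μ b ≤ 1 := by
    rw [← hμ1]; exact Finset.single_le_sum (fun z _ => hμ z) (Finset.mem_univ b)
  have h1 : Real.log (1 - 2 / 3 * μ b) ≤ -δ := by
    rw [Real.log_le_iff_le_exp (by linarith)]; linarith
  have h8 : Real.log 8 ≤ 3 * 0.6931471808 := by
    have : (8 : ℝ) = 2 ^ 3 := by norm_num
    rw [this, Real.log_pow]
    have := Real.log_two_lt_d9
    push_cast; linarith
  have h80 : 0 ≤ Real.log 8 := Real.log_nonneg (by norm_num)
  have h2 : tilt μ u l b * Real.log 8 ≤ μ b / 20 * (3 * 0.6931471808) := by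
    have := tilt_nonneg hμ u l b
    gcongr
  have h3 : 0 < 1 - 7 / 8 * μ b := by linarith
  have h4 : 0 < 1 - 2 / 3 * μ b := by linarith
  have h5 := Real.one_sub_inv_le_log_of_pos (div_pos h4 h3)
  rw [Real.log_div h4.ne' h3.ne', inv_div] at h5
  have h6 : (1 - 7 / 8 * μ b) / (1 - 2 / 3 * μ b) ≤ 1 - 5 / 24 * μ b := by
    rw [div_le_iff₀ h4]; nlinarith
  linarith

/-- A tilt whose entropy is exactly `δ`, which makes `1 / l` a stationary point of the dual
objective, and which keeps a fixed fraction of the mass of `b`. -/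
lemma exists_tiltEntropy_eq (hμ : ∀ y, 0 ≤ μ y) (hμ1 : ∑ y, μ y = 1) {δ : ℝ} {a b : Y}
    (ha : 0 < μ a) (hb : 0 < μ b) (hab : u a < u b) (hδ0 : 0 < δ)
    (hδ : 1 - Real.exp (-δ) ≤ 2 / 3 * μ b) :
    ∃ l, 0 < l ∧ tiltEntropy μ u l = δ ∧ μ b / 20 ≤ tilt μ u l b := by
  have hZ := laplaceSum_pos hμ hμ1 u
  have ha1 : μ a ≤ 1 := by
    rw [← hμ1]; exact Finset.single_le_sum (fun z _ => hμ z) (Finset.mem_univ a)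
  have hcZ : Continuous (laplaceSum μ u) := by unfold laplaceSum; fun_prop
  have hct : ∀ y, Continuous fun l => tilt μ u l y := fun y => by
    unfold tilt
    exact (by fun_prop : Continuous fun l => μ y * Real.exp (-l * u y)).div hcZ
      fun l => (hZ l).ne'
  have hc : Continuous (tiltEntropy μ u) := by
    unfold tiltEntropy
    exact (continuous_neg.mul (continuous_finsetSum _ fun y _ => (hct y).mul continuous_const)).sub
      (hcZ.log fun l => (hZ l).ne')
  have h0 : tiltEntropy μ u 0 = 0 := by simp [tiltEntropy, laplaceSum, hμ1]
  -- at this `L` the tilt has at most a twentieth of the mass of `b` left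
  set L := Real.log (20 / μ a) / (u b - u a) with hL
  have hL0 : 0 ≤ L := div_nonneg (Real.log_nonneg (by rw [le_div_iff₀ ha]; linarith)) (by linarith)
  have htL : tilt μ u L b ≤ μ b / 20 := by
    rw [tilt, div_le_iff₀ (hZ L)]
    have h1 : μ a * Real.exp (-L * u a) ≤ laplaceSum μ u L :=
      Finset.single_le_sum (f := fun y => μ y * Real.exp (-L * u y))
        (fun z _ => mul_nonneg (hμ z) (Real.exp_pos _).le) (Finset.mem_univ a)
    have h2 : Real.exp (-L * u b) = μ a / 20 * Real.exp (-L * u a) := by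
      have h3 : -L * u b = -Real.log (20 / μ a) + -L * u a := by
        have : L * (u b - u a) = Real.log (20 / μ a) := by
          rw [hL]; exact div_mul_cancel₀ _ (by linarith : u b - u a ≠ 0)
        linarith
      rw [h3, Real.exp_add, Real.exp_neg, Real.exp_log (by positivity), inv_div]
    rw [h2]
    calc μ b * (μ a / 20 * Real.exp (-L * u a)) = μ b / 20 * (μ a * Real.exp (-L * u a)) := by ring
      _ ≤ _ := by gcongr
  have hLδ := lt_tiltEntropy (u := u) hμ hμ1 hb hδ htL
  obtain ⟨l, hl, hlδ⟩ := intermediate_value_Icc hL0 hc.continuousOn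
    (⟨h0.le.trans hδ0.le, hLδ.le⟩ : δ ∈ Set.Icc (tiltEntropy μ u 0) (tiltEntropy μ u L))
  refine ⟨l, lt_of_le_of_ne hl.1 ?_, hlδ, ?_⟩
  · rintro rfl
    rw [h0] at hlδ
    exact hδ0.ne hlδ
  · by_contra h
    exact (lt_tiltEntropy (u := u) hμ hμ1 hb hδ (not_le.1 h).le).ne' hlδ

/-- The entropy of the tilt in terms of the shifted exponent `l (u - c)`. -/
lemma tiltEntropy_eq (hμ : ∀ y, 0 ≤ μ y) (hμ1 : ∑ y, μ y = 1) (l c : ℝ) :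
    tiltEntropy μ u l = -((∑ y, μ y * (l * (u y - c) * Real.exp (-(l * (u y - c))))) /
      ∑ y, μ y * Real.exp (-(l * (u y - c))))
      - Real.log (∑ y, μ y * Real.exp (-(l * (u y - c)))) := by
  have hZ := laplaceSum_pos hμ hμ1 u l
  have h0 : ∀ y, Real.exp (-(l * (u y - c))) = Real.exp (l * c) * Real.exp (-l * u y) := fun y => by
    rw [← Real.exp_add]; congr 1; ring
  have h1 : ∑ y, μ y * Real.exp (-(l * (u y - c))) = Real.exp (l * c) * laplaceSum μ u l := by
    rw [laplaceSum, Finset.mul_sum]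
    exact Finset.sum_congr rfl fun y _ => by rw [h0]; ring
  have h2 : (∑ y, μ y * (l * (u y - c) * Real.exp (-(l * (u y - c))))) / (Real.exp (l * c) *
      laplaceSum μ u l) = l * ∑ y, tilt μ u l y * u y - l * c := by
    have h3 : ∀ y, μ y * (l * (u y - c) * Real.exp (-(l * (u y - c))))
        = Real.exp (l * c) * laplaceSum μ u l
          * (l * (tilt μ u l y * u y) - l * c * tilt μ u l y) := fun y => by
      rw [h0, tilt]; field_simp
    simp_rw [h3, ← Finset.mul_sum, Finset.sum_sub_distrib, ← Finset.mul_sum, sum_tilt hμ hμ1]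
    rw [mul_div_cancel_left₀ _ (by positivity)]
    ring
  rw [h1, h2, Real.log_mul (Real.exp_pos _).ne' hZ.ne', Real.log_exp, tiltEntropy]
  ring

lemma abs_log_le_of_abs_sub_one_le {x r : ℝ} (h : |x - 1| ≤ r) (hr : r ≤ 1 / 2) :
    |Real.log x| ≤ 2 * r := by
  have h' := abs_le.1 h
  have hx : 1 / 2 ≤ x := by linarith
  have h0 : 0 < x := by linarith
  rw [abs_le]
  constructor
  · have := Real.one_sub_inv_le_log_of_pos h0
    have h2 : x⁻¹ ≤ 1 + 2 * r := by
      rw [inv_le_iff_one_le_mul₀ h0]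
      nlinarith
    linarith
  · have := Real.log_le_sub_one_of_pos h0
    linarith

lemma abs_sum_sub_sum_le {μ' μ f : Y → ℝ} {ε : ℝ} (h : ∀ y, |μ' y - μ y| ≤ ε * μ y)
    (hf : ∀ y, 0 < μ y → 0 ≤ f y) (hμ : ∀ y, 0 ≤ μ y) :
    |∑ y, μ' y * f y - ∑ y, μ y * f y| ≤ ε * ∑ y, μ y * f y := by
  rw [← Finset.sum_sub_distrib, Finset.mul_sum]
  refine (Finset.abs_sum_le_sum_abs _ _).trans (Finset.sum_le_sum fun y _ => ?_)
  rw [← sub_mul, abs_mul]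
  rcases (hμ y).eq_or_lt with h0 | h0
  · have := h y
    rw [← h0, mul_zero] at this
    rw [← h0, le_antisymm this (abs_nonneg _)]
    simp
  · rw [abs_of_nonneg (hf y h0), ← mul_assoc]
    exact mul_le_mul_of_nonneg_right (h y) (hf y h0)

/-- A relative perturbation of the weights by `ε` changes the entropy of the tilt by `O(ε ρ)`,
where `ρ` bounds the oscillation of the exponent `l u`. -/
lemma abs_tiltEntropy_sub_le {μ' : Y → ℝ} (hμ : ∀ y, 0 ≤ μ y) (hμ1 : ∑ y, μ y = 1)
    (hμ' : ∀ y, 0 ≤ μ' y) (hμ'1 : ∑ y, μ' y = 1) {ε l ρ c : ℝ} (hε0 : 0 ≤ ε) (hε : ε ≤ 1 / 6)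
    (h : ∀ y, |μ' y - μ y| ≤ ε * μ y) (hv0 : ∀ y, 0 < μ y → 0 ≤ l * (u y - c))
    (hv1 : ∀ y, 0 < μ y → l * (u y - c) ≤ ρ) :
    |tiltEntropy μ' u l - tiltEntropy μ u l| ≤ 10 * ε * ρ := by
  rw [tiltEntropy_eq hμ hμ1 l c, tiltEntropy_eq hμ' hμ'1 l c]
  set v : Y → ℝ := fun y => l * (u y - c) with hv
  change ∀ y, 0 < μ y → 0 ≤ v y at hv0
  change ∀ y, 0 < μ y → v y ≤ ρ at hv1
  set A := ∑ y, μ y * (v y * Real.exp (-v y))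
  set A' := ∑ y, μ' y * (v y * Real.exp (-v y))
  set Z := ∑ y, μ y * Real.exp (-v y)
  set Z' := ∑ y, μ' y * Real.exp (-v y)
  change |-(A' / Z') - Real.log Z' - (-(A / Z) - Real.log Z)| ≤ _
  have hZ : 0 < Z := by simpa [laplaceSum] using laplaceSum_pos hμ hμ1 v 1
  have hZ' : 0 < Z' := by simpa [laplaceSum] using laplaceSum_pos hμ' hμ'1 v 1
  have hsum : ∀ f : Y → ℝ, (∀ y, 0 < μ y → f y ≤ ρ * Real.exp (-v y)) →
      ∑ y, μ y * f y ≤ ρ * Z := by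
    intro f hf
    rw [Finset.mul_sum]
    refine Finset.sum_le_sum fun y _ => ?_
    rcases (hμ y).eq_or_lt with h0 | h0
    · simp [← h0]
    · calc μ y * f y ≤ μ y * (ρ * Real.exp (-v y)) := by gcongr; exact hf y h0
        _ = _ := by ring
  have hAρ : A ≤ ρ * Z := hsum _ fun y hy => by gcongr; exact hv1 y hy
  have hA0 : 0 ≤ A := Finset.sum_nonneg fun y _ => by
    rcases (hμ y).eq_or_lt with h0 | h0
    · simp [← h0]
    · exact mul_nonneg h0.le (mul_nonneg (hv0 y h0) (Real.exp_pos _).le)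
  have hA : |A' - A| ≤ ε * A :=
    abs_sum_sub_sum_le h (fun y hy => mul_nonneg (hv0 y hy) (Real.exp_pos _).le) hμ
  have hZZ : |Z' - Z| ≤ ε * Z := abs_sum_sub_sum_le h (fun y _ => (Real.exp_pos _).le) hμ
  have hρ0 : 0 ≤ ρ := by
    by_contra hneg
    nlinarith
  -- first order: the total masses agree, so only `1 - exp (-v)` matters
  have hZ1 : |Z' - Z| ≤ ε * (1 - Z) := by
    have h1 := abs_sum_sub_sum_le (f := fun y => 1 - Real.exp (-v y)) h
      (fun y hy => by
        have := Real.exp_le_one_iff.2 (neg_nonpos.2 (hv0 y hy))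
        linarith) hμ
    simp only [mul_sub, mul_one, Finset.sum_sub_distrib, hμ1, hμ'1] at h1
    rw [show Z' - Z = -((1 - Z') - (1 - Z)) by ring, abs_neg, mul_sub, mul_one]
    exact h1
  have hZρ : 1 - Z ≤ ρ := by
    have : 1 - Z = ∑ y, μ y * (1 - Real.exp (-v y)) := by
      simp only [mul_sub, mul_one, Finset.sum_sub_distrib, hμ1]; rfl
    rw [this]
    calc ∑ y, μ y * (1 - Real.exp (-v y)) ≤ ∑ y, μ y * ρ := by
          refine Finset.sum_le_sum fun y _ => ?_
          rcases (hμ y).eq_or_lt with h0 | h0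
          · simp [← h0]
          · have := Real.add_one_le_exp (-v y)
            have := hv1 y h0
            gcongr; linarith
      _ = ρ := by rw [← Finset.sum_mul, hμ1, one_mul]
  have hlog : |Real.log (Z' / Z)| ≤ 6 * ε * ρ := by
    have hq : |Z' / Z - 1| = |Z' - Z| / Z := by
      rw [div_sub_one hZ.ne', abs_div, abs_of_pos hZ]
    rcases le_total ρ (2 / 3) with h1 | h1
    · have hZ3 : 1 / 3 ≤ Z := by linarith
      have : |Z' / Z - 1| ≤ 3 * (ε * ρ) := by
        rw [hq, div_le_iff₀ hZ]
        nlinarith [mul_nonneg hε0 hρ0, mul_le_mul_of_nonneg_left hZρ hε0]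
      refine (abs_log_le_of_abs_sub_one_le this ?_).trans (by linarith)
      nlinarith
    · have : |Z' / Z - 1| ≤ ε := by rw [hq, div_le_iff₀ hZ]; exact hZZ
      refine (abs_log_le_of_abs_sub_one_le this (by linarith)).trans ?_
      nlinarith
  have hfrac : |A' / Z' - A / Z| ≤ 4 * ε * ρ := by
    have h1 : A' / Z' - A / Z = ((A' - A) * Z - A * (Z' - Z)) / (Z' * Z) := by
      field_simp; ring
    have h2 : |(A' - A) * Z - A * (Z' - Z)| ≤ 2 * ε * A * Z := by
      refine (abs_sub _ _).trans ?_
      rw [abs_mul, abs_mul, abs_of_pos hZ, abs_of_nonneg hA0]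
      nlinarith [mul_le_mul_of_nonneg_right hA hZ.le, mul_le_mul_of_nonneg_left hZZ hA0]
    have h3 : Z ≤ 2 * Z' := by
      have := (abs_le.1 hZZ).1
      nlinarith
    rw [h1, abs_div, abs_of_pos (mul_pos hZ' hZ), div_le_iff₀ (mul_pos hZ' hZ)]
    refine h2.trans ?_
    have h4 : ε * A * Z ≤ ε * (ρ * Z) * Z := by gcongr
    have h5 : ε * ρ * Z * Z ≤ ε * ρ * (2 * Z') * Z := by gcongr
    nlinarith
  rw [Real.log_div hZ'.ne' hZ.ne'] at hlog
  rw [show -(A' / Z') - Real.log Z' - (-(A / Z) - Real.log Z)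
    = -(A' / Z' - A / Z) - (Real.log Z' - Real.log Z) by ring]
  refine (abs_sub _ _).trans ?_
  rw [abs_neg]
  linarith

end Tilt

/-! ### The dual value and its midpoint defect -/

section Dual
variable {Y : Type*} [Fintype Y] {μ u : Y → ℝ}

lemma dualObjective_zero {δ : ℝ} {a : Y} (ha : 0 < μ a) (hmin : ∀ y, 0 < μ y → u a ≤ u y) :
    dualObjective δ μ u 0 = u a := by
  rw [dualObjective, if_pos rfl]
  have : Nonempty {y : Y // 0 < μ y} := ⟨⟨a, ha⟩⟩
  refine le_antisymm ?_ (le_ciInf fun y => hmin y y.2)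
  exact ciInf_le (Set.finite_range fun y : {y : Y // 0 < μ y} => u y).bddBelow ⟨a, ha⟩

lemma laplaceSum_le (hμ : ∀ y, 0 ≤ μ y) (hμ1 : ∑ y, μ y = 1) {l c : ℝ} (hl : 0 < l)
    (hc : ∀ y, 0 < μ y → c ≤ u y) : laplaceSum μ u l ≤ Real.exp (-l * c) := by
  rw [← one_mul (Real.exp _), ← hμ1, Finset.sum_mul]
  refine Finset.sum_le_sum fun y _ => ?_
  rcases (hμ y).eq_or_lt with h | h
  · simp [← h]
  · have := hc y h
    gcongr 1
    exact Real.exp_le_exp.2 (by nlinarith)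

lemma le_laplaceSum (hμ : ∀ y, 0 ≤ μ y) (hμ1 : ∑ y, μ y = 1) {l c : ℝ} (hl : 0 < l)
    (hc : ∀ y, 0 < μ y → u y ≤ c) : Real.exp (-l * c) ≤ laplaceSum μ u l := by
  rw [← one_mul (Real.exp _), ← hμ1, Finset.sum_mul]
  refine Finset.sum_le_sum fun y _ => ?_
  rcases (hμ y).eq_or_lt with h | h
  · simp [← h]
  · have := hc y h
    gcongr 1
    exact Real.exp_le_exp.2 (by nlinarith)

lemma dualObjective_inv_le (hμ : ∀ y, 0 ≤ μ y) (hμ1 : ∑ y, μ y = 1) (δ : ℝ) {l c : ℝ}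
    (hl : 0 < l) (hc : ∀ y, 0 < μ y → u y ≤ c) : dualObjective δ μ u l⁻¹ ≤ c - δ / l := by
  have h := Real.log_le_log (Real.exp_pos _) (le_laplaceSum hμ hμ1 hl hc)
  rw [Real.log_exp] at h
  rw [dualObjective_inv _ _ _ hl, div_le_iff₀ hl, sub_mul, div_mul_cancel₀ _ hl.ne']
  linarith

lemma le_dualObjective_inv (hμ : ∀ y, 0 ≤ μ y) (hμ1 : ∑ y, μ y = 1) (δ : ℝ) {l c : ℝ}
    (hl : 0 < l) (hc : ∀ y, 0 < μ y → c ≤ u y) : c - δ / l ≤ dualObjective δ μ u l⁻¹ := by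
  have h := Real.log_le_log (laplaceSum_pos hμ hμ1 u l) (laplaceSum_le hμ hμ1 hl hc)
  rw [Real.log_exp] at h
  rw [dualObjective_inv _ _ _ hl, le_div_iff₀ hl, sub_mul, div_mul_cancel₀ _ hl.ne']
  linarith

lemma dualObjective_le (hμ : ∀ y, 0 ≤ μ y) (hμ1 : ∑ y, μ y = 1) {δ c α : ℝ} (hδ : 0 < δ)
    (hα : 0 ≤ α) (hc : ∀ y, 0 < μ y → u y ≤ c) : dualObjective δ μ u α ≤ c := by
  rcases hα.eq_or_lt with h | h
  · obtain ⟨a, ha, hmin⟩ := exists_min_of_sum_eq_one hμ1 u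
    rw [← h, dualObjective_zero ha hmin]
    exact hc a ha
  · have h1 := dualObjective_inv_le hμ hμ1 δ (inv_pos.2 h) hc
    rw [inv_inv] at h1
    have : 0 ≤ δ / α⁻¹ := by positivity
    linarith

lemma dualValue_le (hμ : ∀ y, 0 ≤ μ y) (hμ1 : ∑ y, μ y = 1) {δ c : ℝ} (hδ : 0 < δ)
    (hc : ∀ y, 0 < μ y → u y ≤ c) : dualValue δ μ u ≤ c :=
  ciSup_le fun α : Set.Ici (0 : ℝ) => dualObjective_le hμ hμ1 hδ α.2 hc

lemma dualObjective_le_dualValue (hμ : ∀ y, 0 ≤ μ y) (hμ1 : ∑ y, μ y = 1) {δ α : ℝ}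
    (hδ : 0 < δ) (hα : 0 ≤ α) : dualObjective δ μ u α ≤ dualValue δ μ u := by
  have hb : BddAbove (Set.range fun α : Set.Ici (0 : ℝ) => dualObjective δ μ u α) := by
    refine ⟨∑ y, |u y|, ?_⟩
    rintro _ ⟨α, rfl⟩
    exact dualObjective_le hμ hμ1 hδ α.2 fun y _ => (le_abs_self _).trans
      (Finset.single_le_sum (f := fun y => |u y|) (fun z _ => abs_nonneg _) (Finset.mem_univ y))
  exact le_ciSup hb (⟨α, hα⟩ : Set.Ici (0 : ℝ))

lemma le_dualValue (hμ : ∀ y, 0 ≤ μ y) (hμ1 : ∑ y, μ y = 1) {δ c : ℝ} (hδ : 0 < δ)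
    (hc : ∀ y, 0 < μ y → c ≤ u y) : c ≤ dualValue δ μ u := by
  obtain ⟨a, ha, hmin⟩ := exists_min_of_sum_eq_one hμ1 u
  have := dualObjective_le_dualValue (u := u) hμ hμ1 hδ le_rfl
  rw [dualObjective_zero ha hmin] at this
  exact (hc a ha).trans this

lemma abs_dualValue_le (hμ : ∀ y, 0 ≤ μ y) (hμ1 : ∑ y, μ y = 1) {δ U : ℝ} (hδ : 0 < δ)
    (hU : ∀ y, |u y| ≤ U) : |dualValue δ μ u| ≤ U :=
  abs_le.2 ⟨le_dualValue hμ hμ1 hδ fun y _ => (abs_le.1 (hU y)).1,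
    dualValue_le hμ hμ1 hδ fun y _ => (abs_le.1 (hU y)).2⟩

/-- To bound the dual value it suffices to bound the objective on `0 < α ≤ 2 U / δ`: larger `α` give
less than the essential infimum, which is the limit of the objective as `α → 0`. -/
lemma dualValue_le_of_forall (hμ : ∀ y, 0 ≤ μ y) (hμ1 : ∑ y, μ y = 1) {δ U B : ℝ}
    (hδ : 0 < δ) (hU0 : 0 < U) (hU : ∀ y, |u y| ≤ U)
    (hB : ∀ l, 0 < l → 1 / l ≤ 2 * U / δ → dualObjective δ μ u l⁻¹ ≤ B) :
    dualValue δ μ u ≤ B := by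
  obtain ⟨a, ha, hmin⟩ := exists_min_of_sum_eq_one hμ1 u
  have haB : u a ≤ B := by
    refine le_of_forall_pos_le_add fun e he => ?_
    set α := min (e / δ) (2 * U / δ)
    have hα : 0 < α := lt_min (by positivity) (by positivity)
    have h1 := hB α⁻¹ (inv_pos.2 hα) (by rw [one_div, inv_inv]; exact min_le_right _ _)
    have h2 := le_dualObjective_inv hμ hμ1 δ (inv_pos.2 hα) hmin
    have h3 : δ / α⁻¹ ≤ e := by
      rw [div_inv_eq_mul]
      calc δ * α ≤ δ * (e / δ) := by gcongr; exact min_le_left _ _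
        _ = e := mul_div_cancel₀ _ hδ.ne'
    linarith
  refine ciSup_le fun ⟨α, hα⟩ => ?_
  rcases (Set.mem_Ici.1 hα).eq_or_lt with h | h
  · simp only [← h]
    rw [dualObjective_zero ha hmin]
    exact haB
  · have hl : 0 < α⁻¹ := inv_pos.2 h
    change dualObjective δ μ u α ≤ B
    rw [← inv_inv α]
    by_cases hαU : α ≤ 2 * U / δ
    · exact hB _ hl (by simpa using hαU)
    · have h1 := dualObjective_inv_le hμ hμ1 δ hl fun y _ => (abs_le.1 (hU y)).2
      have h2 := (abs_le.1 (hU a)).1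
      rw [div_inv_eq_mul] at h1
      rw [not_le, div_lt_iff₀ hδ] at hαU
      linarith

/-- If the tilt at `l₀` has entropy within `k` of `δ`, then `1 / l₀` maximizes the dual objective
up to an error quadratic in `k`. -/
lemma dualValue_le_dualObjective_add (hμ : ∀ y, 0 ≤ μ y) (hμ1 : ∑ y, μ y = 1)
    {δ U l₀ η k : ℝ} {a b : Y} (hδ : 0 < δ) (hU : ∀ y, |u y| ≤ U) (hl₀ : 0 < l₀)
    (hη : 0 < η) (ha : η ≤ tilt μ u l₀ a) (hb : η ≤ tilt μ u l₀ b) (hab : u a < u b)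
    (hk : |tiltEntropy μ u l₀ - δ| ≤ k) (hk' : 10 * k ≤ l₀ * (u b - u a) * η) :
    dualValue δ μ u ≤ dualObjective δ μ u l₀⁻¹
      + 2 * U / δ * (5 * k ^ 2 / (η * (l₀ * (u b - u a)) ^ 2)) := by
  have hU0 : 0 < U := by
    have h1 := (abs_le.1 (hU a)).1
    have h2 := (abs_le.1 (hU b)).2
    linarith
  refine dualValue_le_of_forall hμ hμ1 hδ hU0 hU fun l hl hlU => ?_
  refine (dualObjective_inv_le_add hμ hμ1 hl₀ hl hη ha hb hab hk hk').trans ?_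
  gcongr

lemma dualObjective_inv_eq_of_tiltEntropy_eq {δ l : ℝ} (hl : 0 < l)
    (h : tiltEntropy μ u l = δ) : dualObjective δ μ u l⁻¹ = ∑ y, tilt μ u l y * u y := by
  rw [dualObjective_inv _ _ _ hl, ← h, tiltEntropy]
  field_simp
  ring

lemma inv_le_of_tiltEntropy_eq (hμ : ∀ y, 0 ≤ μ y) (hμ1 : ∑ y, μ y = 1) {δ l U : ℝ}
    (hδ : 0 < δ) (hl : 0 < l) (hU : ∀ y, |u y| ≤ U) (h : tiltEntropy μ u l = δ) :
    l⁻¹ ≤ 2 * U / δ := by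
  have h1 := dualObjective_inv_le hμ hμ1 δ hl fun y _ => (abs_le.1 (hU y)).2
  rw [dualObjective_inv_eq_of_tiltEntropy_eq hl h] at h1
  have h2 : ∑ y, tilt μ u l y * (-U) ≤ ∑ y, tilt μ u l y * u y := Finset.sum_le_sum fun y _ =>
    mul_le_mul_of_nonneg_left (abs_le.1 (hU y)).1 (tilt_nonneg hμ u l y)
  rw [← Finset.sum_mul, sum_tilt hμ hμ1, one_mul] at h2
  rw [le_div_iff₀ hδ, mul_comm, ← div_eq_mul_inv]
  linarith

/-- For a fixed dual variable the objective is convex in the weights, with a second-order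
midpoint defect. -/
lemma dualObjective_midpoint {E O : Y → ℝ} (hμ : ∀ y, 0 ≤ μ y) (hμ1 : ∑ y, μ y = 1)
    {ε l : ℝ} (δ : ℝ) (hl : 0 < l) (hε : ε ≤ 1 / 2) (hE : ∀ y, |E y - μ y| ≤ ε * μ y)
    (hEO : ∀ y, E y + O y = 2 * μ y) :
    dualObjective δ μ u l⁻¹ ≤ 1 / 2 * dualObjective δ E u l⁻¹ + 1 / 2 * dualObjective δ O u l⁻¹ ∧
    1 / 2 * dualObjective δ E u l⁻¹ + 1 / 2 * dualObjective δ O u l⁻¹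
      ≤ dualObjective δ μ u l⁻¹ + ε ^ 2 * l⁻¹ := by
  have hZ := laplaceSum_pos hμ hμ1 u l
  have hEZ : |laplaceSum E u l - laplaceSum μ u l| ≤ ε * laplaceSum μ u l :=
    abs_sum_sub_sum_le hE (fun y _ => (Real.exp_pos _).le) hμ
  have hOZ : laplaceSum O u l = 2 * laplaceSum μ u l - laplaceSum E u l := by
    rw [laplaceSum, laplaceSum, laplaceSum, Finset.mul_sum, ← Finset.sum_sub_distrib]
    refine Finset.sum_congr rfl fun y _ => ?_
    rw [← mul_assoc, ← hEO]; ring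
  set Z := laplaceSum μ u l
  set t := laplaceSum E u l / Z - 1 with ht
  have hE' : laplaceSum E u l = Z * (1 + t) := by rw [ht]; field_simp; ring
  have hO' : laplaceSum O u l = Z * (1 - t) := by rw [hOZ, hE']; ring
  have htε : |t| ≤ ε := by
    rw [hE', show Z * (1 + t) - Z = Z * t by ring, abs_mul, abs_of_pos hZ, mul_comm] at hEZ
    exact le_of_mul_le_mul_right hEZ hZ
  have ht' := abs_le.1 htε
  have h1 : 0 < 1 + t := by linarith
  have h2 : 0 < 1 - t := by linarith
  have ht2 : t ^ 2 ≤ ε ^ 2 := sq_le_sq' ht'.1 ht'.2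
  have hε4 : ε ^ 2 ≤ 1 / 4 := by nlinarith [abs_nonneg t]
  have h3 : Real.log (1 + t) + Real.log (1 - t) = Real.log (1 - t ^ 2) := by
    rw [← Real.log_mul h1.ne' h2.ne']; congr 1; ring
  have h4 : Real.log (1 - t ^ 2) ≤ 0 := Real.log_nonpos (by linarith) (by nlinarith [sq_nonneg t])
  have h5 : -(2 * ε ^ 2) ≤ Real.log (1 - t ^ 2) := by
    have h6 := Real.one_sub_inv_le_log_of_pos (show 0 < 1 - t ^ 2 by linarith)
    have h7 : (1 - t ^ 2)⁻¹ ≤ 1 + 2 * ε ^ 2 := by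
      rw [inv_le_iff_one_le_mul₀ (by linarith)]
      nlinarith [sq_nonneg t]
    linarith
  -- The Laplace sums of the halves are `Z (1 ± t)`, so the defect is `-log (1 - t ^ 2) / (2 l)`.
  have hid : 1 / 2 * dualObjective δ E u l⁻¹ + 1 / 2 * dualObjective δ O u l⁻¹
      = dualObjective δ μ u l⁻¹ + -(1 / 2 * Real.log (1 - t ^ 2)) * l⁻¹ := by
    rw [dualObjective_inv _ _ _ hl, dualObjective_inv _ _ _ hl, dualObjective_inv _ _ _ hl, hE',
      hO', Real.log_mul hZ.ne' h1.ne', Real.log_mul hZ.ne' h2.ne', ← h3]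
    field_simp
    ring
  have hli : 0 < l⁻¹ := inv_pos.2 hl
  rw [hid]
  constructor
  · nlinarith
  · have : -(1 / 2 * Real.log (1 - t ^ 2)) * l⁻¹ ≤ ε ^ 2 * l⁻¹ := by gcongr; linarith
    linarith

lemma half_tilt_le {μ' : Y → ℝ} (hμ : ∀ y, 0 ≤ μ y) (hμ1 : ∑ y, μ y = 1)
    (hμ' : ∀ y, 0 ≤ μ' y) (hμ'1 : ∑ y, μ' y = 1) {ε : ℝ} (hε : ε ≤ 1 / 3)
    (h : ∀ y, |μ' y - μ y| ≤ ε * μ y) (l : ℝ) (y : Y) :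
    1 / 2 * tilt μ u l y ≤ tilt μ' u l y := by
  have hZ := laplaceSum_pos hμ hμ1 u l
  have hZ' := laplaceSum_pos hμ' hμ'1 u l
  have h1 : laplaceSum μ' u l ≤ 4 / 3 * laplaceSum μ u l := by
    have h2 : |laplaceSum μ' u l - laplaceSum μ u l| ≤ ε * laplaceSum μ u l :=
      abs_sum_sub_sum_le h (fun y _ => (Real.exp_pos _).le) hμ
    have := (abs_le.1 h2).2
    nlinarith
  have h3 : 2 / 3 * μ y ≤ μ' y := by
    have := (abs_le.1 (h y)).1
    nlinarith [hμ y]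
  have he := Real.exp_pos (-l * u y)
  rw [tilt, tilt, ← mul_div_assoc, div_le_div_iff₀ hZ hZ']
  have hw := mul_nonneg (hμ y) he.le
  calc 1 / 2 * (μ y * Real.exp (-l * u y)) * laplaceSum μ' u l
      ≤ 1 / 2 * (μ y * Real.exp (-l * u y)) * (4 / 3 * laplaceSum μ u l) := by gcongr
    _ = 2 / 3 * μ y * Real.exp (-l * u y) * laplaceSum μ u l := by ring
    _ ≤ _ := by gcongr

lemma le_tilt_of_min (hμ : ∀ y, 0 ≤ μ y) (hμ1 : ∑ y, μ y = 1) {l : ℝ} (hl : 0 < l) {a : Y}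
    (hmin : ∀ y, 0 < μ y → u a ≤ u y) : μ a ≤ tilt μ u l a := by
  rw [tilt, le_div_iff₀ (laplaceSum_pos hμ hμ1 u l)]
  exact mul_le_mul_of_nonneg_left (laplaceSum_le hμ hμ1 hl hmin) (hμ a)

/-- The second-order difference of the dual value in the weights, when both halves are uniformly
close to a distribution with atoms of size at least `β`. -/
lemma abs_midpoint_dualValue_le_of_close {p E O : Y → ℝ} {β d δ U : ℝ} (hβ0 : 0 < β)
    (hβ1 : β ≤ 1) (hpβ : ∀ y, p y = 0 ∨ β ≤ p y)
    (hE : ∀ y, 0 ≤ E y) (hE1 : ∑ y, E y = 1) (hO : ∀ y, 0 ≤ O y) (hO1 : ∑ y, O y = 1)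
    (hEp : ∀ y, p y = 0 → E y = 0) (hOp : ∀ y, p y = 0 → O y = 0)
    (hEd : ∀ y, |E y - p y| ≤ d) (hOd : ∀ y, |O y - p y| ≤ d) (hd : d ≤ β ^ 2 / 12000)
    (hδ : 0 < δ) (hδβ : 1 - Real.exp (-δ) ≤ 1 / 2 * β) (hU : ∀ y, |u y| ≤ U) :
    |dualValue δ (fun y => (E y + O y) / 2) u - 1 / 2 * dualValue δ E u
      - 1 / 2 * dualValue δ O u| ≤ 300000 * U * d ^ 2 / (δ * β ^ 3) := by
  set μ : Y → ℝ := fun y => (E y + O y) / 2 with hμdef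
  have hμ : ∀ y, 0 ≤ μ y := fun y => by have := hE y; have := hO y; simp only [hμdef]; linarith
  have hμ1 : ∑ y, μ y = 1 := by
    rw [hμdef, ← Finset.sum_div, Finset.sum_add_distrib, hE1, hO1]; norm_num
  obtain ⟨a, ha, hmin⟩ := exists_min_of_sum_eq_one hμ1 u
  obtain ⟨b, hb, hmax⟩ := exists_min_of_sum_eq_one hμ1 (fun y => -u y)
  simp only [neg_le_neg_iff] at hmax
  have hd0 : 0 ≤ d := (abs_nonneg _).trans (hEd a)
  have hU0 : 0 ≤ U := (abs_nonneg _).trans (hU a)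
  have hEpos : ∀ y, 0 < E y → 0 < μ y := fun y h => by
    have := hO y; simp only [hμdef]; linarith
  have hOpos : ∀ y, 0 < O y → 0 < μ y := fun y h => by
    have := hE y; simp only [hμdef]; linarith
  rcases (hmin b hb).eq_or_lt with hab | hab
  · -- the values of `u` on the support agree, so that all three dual values do
    have hconst : ∀ ν : Y → ℝ, (∀ y, 0 ≤ ν y) → ∑ y, ν y = 1 → (∀ y, 0 < ν y → 0 < μ y) →
        dualValue δ ν u = u a := fun ν h0 h1 h2 => le_antisymm
      (dualValue_le h0 h1 hδ fun y hy => hab ▸ hmax y (h2 y hy))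
      (le_dualValue h0 h1 hδ fun y hy => hmin y (h2 y hy))
    rw [hconst μ hμ hμ1 fun _ h => h, hconst E hE hE1 hEpos, hconst O hO hO1 hOpos]
    rw [show u a - 1 / 2 * u a - 1 / 2 * u a = 0 by ring, abs_zero]
    positivity
  have hββ : β ^ 2 ≤ β := by nlinarith
  have hμβ : ∀ y, 0 < μ y → 3 / 4 * β ≤ μ y := by
    intro y hy
    rcases hpβ y with h | h
    · simp only [hμdef, hEp y h, hOp y h] at hy
      norm_num at hy
    · have h1 := (abs_le.1 (hEd y)).1
      have h2 := (abs_le.1 (hOd y)).1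
      simp only [hμdef]
      linarith
  -- a relative error: atoms of `μ` have mass at least `3 β / 4`
  set ε := 2 * d / β with hε
  have hε0 : 0 ≤ ε := by positivity
  have hεβ : ε ≤ β / 6000 := by
    rw [hε, div_le_iff₀ hβ0]; nlinarith
  have hrel : ∀ y, |E y - O y| / 2 ≤ ε * μ y := by
    intro y
    rcases (hμ y).eq_or_lt with h | h
    · have h1 := hE y
      have h2 := hO y
      have h3 : E y + O y = 0 := by
        have : (E y + O y) / 2 = 0 := h.symm
        linarith
      have h4 : E y = 0 := by linarith
      have h5 : O y = 0 := by linarith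
      rw [h4, h5, ← h]; simp
    · have h1 : |E y - O y| ≤ 2 * d := by
        rw [show E y - O y = (E y - p y) - (O y - p y) by ring]
        refine (abs_sub _ _).trans ?_
        have := hEd y
        have := hOd y
        linarith
      have h2 : d ≤ ε * μ y := by
        have : ε * (3 / 4 * β) = 3 / 2 * d := by rw [hε]; field_simp; ring
        nlinarith [mul_le_mul_of_nonneg_left (hμβ y h) hε0]
      linarith
  have hEμ : ∀ y, |E y - μ y| ≤ ε * μ y := fun y => by
    rw [show E y - μ y = (E y - O y) / 2 by simp only [hμdef]; ring, abs_div, abs_two]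
    exact hrel y
  have hOμ : ∀ y, |O y - μ y| ≤ ε * μ y := fun y => by
    rw [show O y - μ y = (O y - E y) / 2 by simp only [hμdef]; ring, abs_div, abs_two, abs_sub_comm]
    exact hrel y
  obtain ⟨l, hl, hlδ, htb⟩ := exists_tiltEntropy_eq (u := u) hμ hμ1 ha hb hab hδ
    (by linarith [hμβ b hb])
  have hta := le_tilt_of_min hμ hμ1 hl hmin
  have hρ : 0 < l * (u b - u a) := mul_pos hl (by linarith)
  set ρ := l * (u b - u a) with hρdef
  have hinv := inv_le_of_tiltEntropy_eq hμ hμ1 hδ hl hU hlδ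
  -- Taking `e = 0` shows that `1 / l` is an exact maximizer for `μ`.
  have upper : ∀ ν : Y → ℝ, (∀ y, 0 ≤ ν y) → ∑ y, ν y = 1 → ∀ e, 0 ≤ e → e ≤ ε →
      (∀ y, |ν y - μ y| ≤ e * μ y) →
      dualValue δ ν u ≤ dualObjective δ ν u l⁻¹ + 60000 * e ^ 2 * U / (δ * β) := by
    intro ν h0 h1 e he0 he h
    -- Atoms of `μ` have mass at least `3 β / 4`, the tilt keeps a twentieth of it, and
    -- passing to `ν` costs at most a factor `2`.
    have hηa : β / 60 ≤ tilt ν u l a := by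
      have := half_tilt_le (u := u) hμ hμ1 h0 h1 (by linarith) h l a
      linarith [hμβ a ha]
    have hηb : β / 60 ≤ tilt ν u l b := by
      have := half_tilt_le (u := u) hμ hμ1 h0 h1 (by linarith) h l b
      linarith [hμβ b hb]
    have hk := abs_tiltEntropy_sub_le (u := u) (l := l) (c := u a) (ρ := ρ) hμ hμ1 h0 h1 he0
      (by linarith) h (fun y hy => mul_nonneg hl.le (by linarith [hmin y hy]))
      (fun y hy => mul_le_mul_of_nonneg_left (by linarith [hmax y hy]) hl.le)
    rw [hlδ] at hk
    refine (dualValue_le_dualObjective_add h0 h1 hδ hU hl (by positivity) hηa hηb hab hk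
      ?_).trans (le_of_eq ?_)
    · rw [← hρdef]
      have : e * ρ ≤ β / 6000 * ρ := by gcongr; linarith
      linarith
    · rw [← hρdef]
      field_simp
      ring
  have hmid := dualObjective_midpoint (u := u) hμ hμ1 δ hl (by linarith) hEμ
    (fun y => by simp only [hμdef]; ring : ∀ y, E y + O y = 2 * μ y)
  have hμle := upper μ hμ hμ1 0 le_rfl hε0 (by simp)
  have hEle := upper E hE hE1 ε hε0 le_rfl hEμ
  have hOle := upper O hO hO1 ε hε0 le_rfl hOμ
  have hli : 0 ≤ l⁻¹ := by positivity
  have hμge := dualObjective_le_dualValue (u := u) hμ hμ1 hδ hli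
  have hEge := dualObjective_le_dualValue (u := u) hE hE1 hδ hli
  have hOge := dualObjective_le_dualValue (u := u) hO hO1 hδ hli
  have e1 : 60000 * ε ^ 2 * U / (δ * β) = 240000 * U * d ^ 2 / (δ * β ^ 3) := by
    rw [hε]; field_simp; ring
  have e2 : ε ^ 2 * l⁻¹ ≤ 8 * U * d ^ 2 / (δ * β ^ 3) := by
    calc ε ^ 2 * l⁻¹ ≤ ε ^ 2 * (2 * U / δ) := by gcongr
      _ = 8 * U * d ^ 2 / (δ * β ^ 3) * β := by rw [hε]; field_simp; ring
      _ ≤ 8 * U * d ^ 2 / (δ * β ^ 3) * 1 := by gcongr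
      _ = _ := mul_one _
  have e3 : 300000 * U * d ^ 2 / (δ * β ^ 3) = 240000 * U * d ^ 2 / (δ * β ^ 3)
      + 8 * U * d ^ 2 / (δ * β ^ 3) + 59992 * U * d ^ 2 / (δ * β ^ 3) := by ring
  have e4 : 0 ≤ 59992 * U * d ^ 2 / (δ * β ^ 3) := by positivity
  have e5 : 0 ≤ 8 * U * d ^ 2 / (δ * β ^ 3) := by positivity
  have e6 : 0 ≤ 240000 * U * d ^ 2 / (δ * β ^ 3) := by positivity
  rw [e1] at hEle hOle
  have hz : 60000 * (0 : ℝ) ^ 2 * U / (δ * β) = 0 := by simp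
  rw [hz] at hμle
  rw [abs_le]
  constructor <;> linarith [hmid.1, hmid.2]

lemma radius_le_of_one_sub_exp_le {β δ : ℝ} (hβ0 : 0 < β) (hβ1 : β ≤ 1)
    (hδβ : 1 - Real.exp (-δ) ≤ 1 / 2 * β) : δ ≤ β := by
  by_contra h
  have h1 : Real.exp (-δ) ≤ Real.exp (-β) := Real.exp_le_exp.2 (by linarith)
  have h2 : Real.exp (-β) ≤ 1 / (1 + β) := by
    rw [Real.exp_neg, ← one_div]
    exact one_div_le_one_div_of_le (by linarith) (by linarith [Real.add_one_le_exp β])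
  have h3 : 1 / (1 + β) ≤ 1 - 1 / 2 * β := by
    rw [div_le_iff₀ (by linarith)]; nlinarith
  have h4 : Real.exp (-δ) < Real.exp (-β) := Real.exp_lt_exp.2 (by linarith)
  linarith

/-- The second-order difference of the dual value is quadratic in the distance `d` of the two
halves from the sampling distribution. For large `d` this is the trivial bound `2 U`. -/
lemma abs_midpoint_dualValue_le {p E O : Y → ℝ} {β d δ U : ℝ} (hβ0 : 0 < β)
    (hβ1 : β ≤ 1) (hpβ : ∀ y, p y = 0 ∨ β ≤ p y)
    (hE : ∀ y, 0 ≤ E y) (hE1 : ∑ y, E y = 1) (hO : ∀ y, 0 ≤ O y) (hO1 : ∑ y, O y = 1)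
    (hEp : ∀ y, p y = 0 → E y = 0) (hOp : ∀ y, p y = 0 → O y = 0)
    (hEd : ∀ y, |E y - p y| ≤ d) (hOd : ∀ y, |O y - p y| ≤ d)
    (hδ : 0 < δ) (hδβ : 1 - Real.exp (-δ) ≤ 1 / 2 * β) (hU : ∀ y, |u y| ≤ U) :
    |dualValue δ (fun y => (E y + O y) / 2) u - 1 / 2 * dualValue δ E u
      - 1 / 2 * dualValue δ O u| ≤ 300000000 * U * d ^ 2 / (δ * β ^ 3) := by
  have hU0 : 0 ≤ U := by
    obtain ⟨a, -⟩ := exists_min_of_sum_eq_one hE1 u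
    exact (abs_nonneg _).trans (hU a)
  -- Below this threshold the relative error is at most a fixed fraction of the tilted masses.
  rcases le_total d (β ^ 2 / 12000) with hd | hd
  · refine (abs_midpoint_dualValue_le_of_close hβ0 hβ1 hpβ hE hE1 hO hO1 hEp hOp hEd hOd hd hδ
      hδβ hU).trans ?_
    gcongr
    norm_num
  · have hμ : ∀ y, 0 ≤ (E y + O y) / 2 := fun y => by have := hE y; have := hO y; linarith
    have hμ1 : ∑ y, (E y + O y) / 2 = 1 := by
      rw [← Finset.sum_div, Finset.sum_add_distrib, hE1, hO1]; norm_num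
    have h1 := abs_le.1 (abs_dualValue_le hμ hμ1 hδ hU)
    have h2 := abs_le.1 (abs_dualValue_le hE hE1 hδ hU)
    have h3 := abs_le.1 (abs_dualValue_le hO hO1 hδ hU)
    have h4 : 2 * U ≤ 300000000 * U * d ^ 2 / (δ * β ^ 3) := by
      rw [le_div_iff₀ (by positivity)]
      have h5 : (β ^ 2 / 12000) ^ 2 ≤ d ^ 2 := by gcongr
      have h6 : δ * β ^ 3 ≤ β * β ^ 3 := by
        gcongr; exact radius_le_of_one_sub_exp_le hβ0 hβ1 hδβ
      have h7 : δ * β ^ 3 ≤ 150000000 * d ^ 2 := by nlinarith [sq_nonneg (β ^ 2)]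
      nlinarith
    refine le_trans ?_ h4
    rw [abs_le]
    constructor <;> linarith [h1.1, h1.2, h2.1, h2.2, h3.1, h3.2]

end Dual

/-! ### Empirical distributions and their deviations -/

section Empirical
variable {Y : Type*}

open Classical in
lemma empirical_eq_sum (m : ℕ) (x : ℕ → Y) (y : Y) :
    empirical m x y = (∑ i ∈ Finset.range m, if x i = y then (1 : ℝ) else 0) / m := by
  rw [empirical, Finset.sum_boole]

lemma empirical_nonneg (m : ℕ) (x : ℕ → Y) (y : Y) : 0 ≤ empirical m x y := by
  unfold empirical; positivity

lemma sum_empirical [Fintype Y] {m : ℕ} (hm : m ≠ 0) (x : ℕ → Y) :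
    ∑ y, empirical m x y = 1 := by
  classical
  simp_rw [empirical_eq_sum]
  rw [← Finset.sum_div, Finset.sum_comm]
  simp [hm]

lemma empirical_eq_zero {m : ℕ} {x : ℕ → Y} {y : Y} (h : ∀ i, x i ≠ y) :
    empirical m x y = 0 := by
  classical
  simp [empirical_eq_sum, h]

lemma sum_range_two_mul {M : Type*} [AddCommMonoid M] (f : ℕ → M) (m : ℕ) :
    ∑ i ∈ Finset.range (2 * m), f i
      = ∑ i ∈ Finset.range m, f (2 * i + 1) + ∑ i ∈ Finset.range m, f (2 * i) := by
  induction m with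
  | zero => simp
  | succ m ih =>
    rw [show 2 * (m + 1) = 2 * m + 1 + 1 by ring, Finset.sum_range_succ, Finset.sum_range_succ,
      ih, Finset.sum_range_succ, Finset.sum_range_succ]
    abel

lemma empirical_two_pow_succ (n : ℕ) (x : ℕ → Y) :
    empirical (2 ^ (n + 1)) x = fun y => (empirical (2 ^ n) (fun i => x (2 * i + 1)) y
      + empirical (2 ^ n) (fun i => x (2 * i)) y) / 2 := by
  classical
  funext y
  rw [empirical_eq_sum, empirical_eq_sum, empirical_eq_sum, pow_succ', sum_range_two_mul]
  push_cast
  field_simp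

lemma empirical_congr {m : ℕ} {x x' : ℕ → Y} (h : ∀ i < m, x i = x' i) :
    empirical m x = empirical m x' := by
  classical
  funext y
  rw [empirical_eq_sum, empirical_eq_sum]
  congr 1
  exact Finset.sum_congr rfl fun i hi => by rw [h i (Finset.mem_range.1 hi)]

variable [Fintype Y]

lemma levelDifference_congr {δ : ℝ} {u : Y → ℝ} {n : ℕ} {x x' : ℕ → Y}
    (h : ∀ i < 2 ^ (n + 1), x i = x' i) :
    levelDifference δ u n x = levelDifference δ u n x' := by
  have hp : 2 ^ (n + 1) = 2 * 2 ^ n := pow_succ' 2 n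
  rw [levelDifference, levelDifference, empirical_congr h,
    empirical_congr (m := 2 ^ n) (x := fun i => x (2 * i)) fun i hi => h _ (by omega),
    empirical_congr (m := 2 ^ n) (x := fun i => x (2 * i + 1)) fun i hi => h _ (by omega)]

/-- The multilevel difference depends on finitely many sample points from a discrete space. -/
lemma measurable_levelDifference [MeasurableSpace Y] [DiscreteMeasurableSpace Y] (δ : ℝ)
    (u : Y → ℝ) (n : ℕ) : Measurable fun x : ℕ → Y => levelDifference δ u n x := by
  rcases isEmpty_or_nonempty Y with hY | ⟨⟨y₀⟩⟩
  · exact measurable_of_empty _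
  let extend : (Fin (2 ^ (n + 1)) → Y) → ℕ → Y := fun z i =>
    if h : i < 2 ^ (n + 1) then z ⟨i, h⟩ else y₀
  have h1 : (fun x : ℕ → Y => levelDifference δ u n x)
      = (fun z => levelDifference δ u n (extend z)) ∘ fun x i => x (i : ℕ) := by
    funext x
    exact levelDifference_congr fun i hi => by simp [extend, hi]
  rw [h1]
  exact (Measurable.of_discrete).comp (measurable_pi_lambda _ fun i => measurable_pi_apply _)

lemma abs_levelDifference_le {q : PMF Y} {β d δ U : ℝ} {u : Y → ℝ} {n : ℕ} {x : ℕ → Y}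
    (hβ0 : 0 < β) (hβ1 : β ≤ 1) (hqβ : ∀ y ∈ q.support, β ≤ (q y).toReal)
    (hx : ∀ i, x i ∈ q.support)
    (hE : ∀ y, |empirical (2 ^ n) (fun i => x (2 * i + 1)) y - (q y).toReal| ≤ d)
    (hO : ∀ y, |empirical (2 ^ n) (fun i => x (2 * i)) y - (q y).toReal| ≤ d)
    (hδ : 0 < δ) (hδβ : 1 - Real.exp (-δ) ≤ 1 / 2 * β) (hU : ∀ y, |u y| ≤ U) :
    |levelDifference δ u n x| ≤ 300000000 * U * d ^ 2 / (δ * β ^ 3) := by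
  have hq0 : ∀ y, (q y).toReal = 0 → ∀ i, x i ≠ y := by
    rintro y hy i rfl
    have := hqβ _ (hx i)
    linarith
  rw [levelDifference, empirical_two_pow_succ]
  refine abs_midpoint_dualValue_le hβ0 hβ1 (fun y => ?_) (empirical_nonneg _ _)
    (sum_empirical (by positivity) _) (empirical_nonneg _ _) (sum_empirical (by positivity) _)
    (fun y hy => empirical_eq_zero fun i => hq0 y hy _)
    (fun y hy => empirical_eq_zero fun i => hq0 y hy _) hE hO hδ hδβ hU
  by_cases h : y ∈ q.support
  · exact Or.inr (hqβ y h)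
  · left
    rw [PMF.mem_support_iff, not_not] at h
    simp [h]

end Empirical

/-- A fourth power is at most of order `L ^ 2` plus exponentials that remain small after summing
over `exp L` variables with sub-Gaussian tails. This gives maximal inequalities without integrating
tail probabilities. -/
lemma pow_four_le_add_exp {L : ℝ} (hL : 1 ≤ L) (z : ℝ) :
    z ^ 4 ≤ 6 * L ^ 2 + 24 * (Real.exp (2 * √L * z - 3 / 2 * L)
      + Real.exp (-(2 * √L) * z - 3 / 2 * L)) := by
  have key : ∀ w : ℝ, 0 ≤ w → w ^ 4 ≤ 6 * L ^ 2 + 24 * Real.exp (2 * √L * w - 3 / 2 * L) := by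
    intro w hw
    have hs : √L ^ 2 = L := Real.sq_sqrt (by linarith)
    have hs1 : 1 ≤ √L := Real.one_le_sqrt.2 hL
    rcases le_total w (3 / 2 * √L) with h | h
    · have h1 : w ^ 4 ≤ (3 / 2 * √L) ^ 4 := by gcongr
      have h2 : (3 / 2 * √L) ^ 4 = 81 / 16 * L ^ 2 := by
        rw [mul_pow, show √L ^ 4 = (√L ^ 2) ^ 2 by ring, hs]; norm_num
      have := Real.exp_pos (2 * √L * w - 3 / 2 * L)
      nlinarith [sq_nonneg L]
    · have h1 : w ≤ 2 * √L * w - 3 / 2 * L := by nlinarith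
      have h2 := Real.pow_div_factorial_le_exp w hw 4
      have h3 := Real.exp_le_exp.2 h1
      norm_num [Nat.factorial] at h2
      nlinarith [sq_nonneg L]
  have e1 := Real.exp_pos (2 * √L * z - 3 / 2 * L)
  have e2 := Real.exp_pos (-(2 * √L) * z - 3 / 2 * L)
  rcases le_total 0 z with h | h
  · linarith [key z h]
  · have := key (-z) (by linarith)
    rw [show 2 * √L * -z = -(2 * √L) * z by ring, show (-z) ^ 4 = z ^ 4 by ring] at this
    linarith

section Sampling
variable {S A Y : Type*}

/-- The deviation of an empirical frequency from its mean: for the state-action pair `i.1` and the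
point `i.2.1`, along the first `2 ^ n` indices of the form `2 j + 1` (if `i.2.2`) or
`2 j` (if not). -/
def halfDeviation (q : S → A → PMF Y) (n : ℕ) (ω : S × A × ℕ → Y) (i : (S × A) × Y × Bool) : ℝ :=
  empirical (2 ^ n) (fun j => ω (i.1.1, i.1.2, 2 * j + i.2.2.toNat)) i.2.1
    - (q i.1.1 i.1.2 i.2.1).toReal

variable [MeasurableSpace Y] [DiscreteMeasurableSpace Y]

/-- The law of independent samples `ω (s, a, j) ∼ q s a`. -/
abbrev sampleLaw (q : S → A → PMF Y) : Measure (S × A × ℕ → Y) :=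
  Measure.infinitePi fun k : S × A × ℕ => (q k.1 k.2.1).toMeasure

lemma ae_mem_support [Countable S] [Countable A] (q : S → A → PMF Y) :
    ∀ᵐ ω ∂sampleLaw q, ∀ k, ω k ∈ (q k.1 k.2.1).support := by
  rw [ae_all_iff]
  intro k
  have hmp := measurePreserving_eval_infinitePi
    (fun k : S × A × ℕ => (q k.1 k.2.1).toMeasure) k
  have h1 : ∀ᵐ y ∂(q k.1 k.2.1).toMeasure, y ∈ (q k.1 k.2.1).support := by
    rw [ae_iff]
    rw [PMF.toMeasure_apply_eq_zero_iff _ (MeasurableSet.of_discrete)]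
    exact Set.disjoint_left.2 fun y hy h => h hy
  exact hmp.quasiMeasurePreserving.ae h1

lemma measurable_halfDeviation (q : S → A → PMF Y) (n : ℕ) (i : (S × A) × Y × Bool) :
    Measurable fun ω : S × A × ℕ → Y => halfDeviation q n ω i := by
  classical
  unfold halfDeviation
  simp_rw [empirical_eq_sum]
  refine ((Finset.measurable_sum _ fun j _ => ?_).div_const _).sub_const _
  exact (Measurable.of_discrete (f := fun z : Y => if z = i.2.1 then (1 : ℝ) else 0)).comp
    (measurable_pi_apply _)

variable [Fintype Y]

open Classical in
lemma hasSubgaussianMGF_sum_indicator (q : S → A → PMF Y) (n : ℕ) (i : (S × A) × Y × Bool) :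
    HasSubgaussianMGF (fun ω : S × A × ℕ → Y => ∑ j ∈ Finset.range (2 ^ n),
      ((if ω (i.1.1, i.1.2, 2 * j + i.2.2.toNat) = i.2.1 then (1 : ℝ) else 0)
        - (q i.1.1 i.1.2 i.2.1).toReal)) (2 ^ n / 4) (sampleLaw q) := by
  obtain ⟨⟨s, a⟩, y, c⟩ := i
  simp only
  let f : Y → ℝ := fun z => if z = y then 1 else 0
  have hf : Measurable f := Measurable.of_discrete
  have hind : iIndepFun (fun (k : S × A × ℕ) (ω : S × A × ℕ → Y) =>
      f (ω k) - (q s a y).toReal) (sampleLaw q) :=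
    iIndepFun_infinitePi (X := fun _ z => f z - (q s a y).toReal)
      fun k => Measurable.of_discrete
  have hinj : Function.Injective fun j : ℕ => ((s, a, 2 * j + c.toNat) : S × A × ℕ) := by
    intro j j' h
    simp only [Prod.mk.injEq, true_and] at h
    omega
  have hsum := HasSubgaussianMGF.sum_of_iIndepFun (s := Finset.range (2 ^ n))
    (c := fun _ => (1 / 2) ^ 2) (hind.precomp hinj) ?_
  · convert hsum using 1
    rw [Finset.sum_const, Finset.card_range, nsmul_eq_mul]
    push_cast
    ring
  intro j _
  have hm : Measurable fun ω : S × A × ℕ → Y => f (ω (s, a, 2 * j + c.toNat)) :=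
    hf.comp (measurable_pi_apply _)
  have h := hasSubgaussianMGF_of_mem_Icc (μ := sampleLaw q) (a := 0) (b := 1) hm.aemeasurable
    (Filter.Eventually.of_forall fun ω => by
      simp only [f]; split_ifs <;> simp)
  have hmean : ∫ ω, f (ω (s, a, 2 * j + c.toNat)) ∂sampleLaw q = (q s a y).toReal := by
    have hmp := measurePreserving_eval_infinitePi
      (fun k : S × A × ℕ => (q k.1 k.2.1).toMeasure) (s, a, 2 * j + c.toNat)
    have h1 := integral_map (μ := sampleLaw q) hmp.measurable.aemeasurable
      (hf.aestronglyMeasurable (μ := (sampleLaw q).map (Function.eval (s, a, 2 * j + c.toNat))))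
    rw [hmp.map_eq, PMF.integral_eq_sum] at h1
    rw [show ∫ ω, f (ω (s, a, 2 * j + c.toNat)) ∂sampleLaw q
      = ∫ ω, f (Function.eval (s, a, 2 * j + c.toNat) ω) ∂sampleLaw q from rfl, ← h1]
    simp [f]
  rw [hmean] at h
  convert h using 1
  simp

/-- Hoeffding's bound for the normalized deviation of an empirical frequency. -/
lemma mgf_halfDeviation (q : S → A → PMF Y) (n : ℕ) (i : (S × A) × Y × Bool) (t : ℝ) :
    Integrable (fun ω => Real.exp (t * (√(2 ^ n) * halfDeviation q n ω i))) (sampleLaw q) ∧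
    ∫ ω, Real.exp (t * (√(2 ^ n) * halfDeviation q n ω i)) ∂sampleLaw q
      ≤ Real.exp (t ^ 2 / 8) := by
  classical
  have h := hasSubgaussianMGF_sum_indicator q n i
  have hs : (0 : ℝ) < √(2 ^ n) := Real.sqrt_pos.2 (by positivity)
  have hs2 : √((2 : ℝ) ^ n) ^ 2 = 2 ^ n := Real.sq_sqrt (by positivity)
  have hrw : ∀ ω : S × A × ℕ → Y, t * (√(2 ^ n) * halfDeviation q n ω i)
      = t / √(2 ^ n) * ∑ j ∈ Finset.range (2 ^ n),
      ((if ω (i.1.1, i.1.2, 2 * j + i.2.2.toNat) = i.2.1 then (1 : ℝ) else 0)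
        - (q i.1.1 i.1.2 i.2.1).toReal) := by
    intro ω
    rw [halfDeviation, empirical_eq_sum, Finset.sum_sub_distrib, Finset.sum_const,
      Finset.card_range, nsmul_eq_mul]
    push_cast
    generalize √((2 : ℝ) ^ n) = r at hs hs2
    rw [← hs2]
    field_simp
  simp_rw [hrw]
  refine ⟨h.integrable_exp_mul _, (h.mgf_le _).trans (le_of_eq ?_)⟩
  congr 1
  push_cast
  rw [div_pow, hs2]
  field_simp
  ring

end Sampling

section QuarticBound
variable {S A Y : Type*} [Fintype S] [Fintype A] [Fintype Y]

/-- One plus the logarithm of the number of deviations over which a maximum is taken. -/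
def logCount (S A Y : Type*) [Fintype S] [Fintype A] [Fintype Y] : ℝ :=
  1 + Real.log (2 * (Fintype.card S * Fintype.card A * Fintype.card Y))

/-- A random variable dominating the fourth powers of all `halfDeviation`s at level `n`:
the right side of `pow_four_le_add_exp` with the exponentials summed over all of them. -/
def quarticBound (q : S → A → PMF Y) (n : ℕ) (ω : S × A × ℕ → Y) : ℝ :=
  (6 * logCount S A Y ^ 2 + 24 * ∑ i,
    (Real.exp (2 * √(logCount S A Y) * (√(2 ^ n) * halfDeviation q n ω i)
        - 3 / 2 * logCount S A Y)
      + Real.exp (-(2 * √(logCount S A Y)) * (√(2 ^ n) * halfDeviation q n ω i)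
        - 3 / 2 * logCount S A Y))) / 4 ^ n

lemma one_le_logCount [Nonempty S] [Nonempty A] [Nonempty Y] : 1 ≤ logCount S A Y := by
  have hS : (1 : ℝ) ≤ Fintype.card S := by exact_mod_cast Fintype.card_pos
  have hA : (1 : ℝ) ≤ Fintype.card A := by exact_mod_cast Fintype.card_pos
  have hY : (1 : ℝ) ≤ Fintype.card Y := by exact_mod_cast Fintype.card_pos
  have h1 : (1 : ℝ) ≤ Fintype.card S * Fintype.card A * Fintype.card Y :=
    one_le_mul_of_one_le_of_one_le (one_le_mul_of_one_le_of_one_le hS hA) hY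
  have := Real.log_nonneg (show (1 : ℝ) ≤ 2 * (Fintype.card S * Fintype.card A * Fintype.card Y)
    by linarith)
  unfold logCount
  linarith

lemma logCount_le {x : ℝ} (hx : 0 < x)
    (h : (Fintype.card S * Fintype.card A * Fintype.card Y : ℝ) = x) :
    logCount S A Y ≤ 3 + Real.log x := by
  rw [logCount, h, Real.log_mul two_ne_zero hx.ne']
  linarith [Real.log_two_lt_d9]

lemma quarticBound_nonneg (q : S → A → PMF Y) (n : ℕ) (ω : S × A × ℕ → Y) :
    0 ≤ quarticBound q n ω := by
  unfold quarticBound; positivity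

lemma halfDeviation_pow_four_le [Nonempty S] [Nonempty A] [Nonempty Y] (q : S → A → PMF Y)
    (n : ℕ) (ω : S × A × ℕ → Y) (i : (S × A) × Y × Bool) :
    halfDeviation q n ω i ^ 4 ≤ quarticBound q n ω := by
  have h1 := pow_four_le_add_exp (one_le_logCount (S := S) (A := A) (Y := Y))
    (√(2 ^ n) * halfDeviation q n ω i)
  have h2 : (√(2 ^ n) * halfDeviation q n ω i) ^ 4 = halfDeviation q n ω i ^ 4 * 4 ^ n := by
    have : √((2 : ℝ) ^ n) ^ 4 = 4 ^ n := by
      rw [show √((2 : ℝ) ^ n) ^ 4 = (√((2 : ℝ) ^ n) ^ 2) ^ 2 by ring, Real.sq_sqrt (by positivity),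
        ← pow_mul, mul_comm, pow_mul]
      norm_num
    rw [mul_pow, this, mul_comm]
  rw [quarticBound, le_div_iff₀ (by positivity), ← h2]
  refine h1.trans ?_
  gcongr
  exact Finset.single_le_sum (f := fun i =>
    Real.exp (2 * √(logCount S A Y) * (√(2 ^ n) * halfDeviation q n ω i)
        - 3 / 2 * logCount S A Y)
      + Real.exp (-(2 * √(logCount S A Y)) * (√(2 ^ n) * halfDeviation q n ω i)
        - 3 / 2 * logCount S A Y)) (fun j _ => by positivity) (Finset.mem_univ i)

/-- On samples within the support, all squared multilevel differences of level `n` are dominated by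
one integrable variable. -/
lemma sq_levelDifference_le [Nonempty S] [Nonempty A] {q : S → A → PMF Y} {β δ U : ℝ}
    {u : Y → ℝ} (hβ0 : 0 < β) (hβ1 : β ≤ 1)
    (hqβ : ∀ s a, ∀ y ∈ (q s a).support, β ≤ (q s a y).toReal)
    (hδ : 0 < δ) (hδβ : 1 - Real.exp (-δ) ≤ 1 / 2 * β) (hU : ∀ y, |u y| ≤ U)
    {ω : S × A × ℕ → Y} (hω : ∀ k, ω k ∈ (q k.1 k.2.1).support) (n : ℕ) (s : S) (a : A) :
    levelDifference δ u n (fun i => ω (s, a, i)) ^ 2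
      ≤ (300000000 / (δ * β ^ 3)) ^ 2 * U ^ 2 * quarticBound q n ω := by
  have : Nonempty Y := ⟨ω (s, a, 0)⟩
  have hB := quarticBound_nonneg q n ω
  -- the fourth root of the bound dominates every deviation
  set d := √(√(quarticBound q n ω)) with hd
  have hd4 : d ^ 4 = quarticBound q n ω := by
    rw [hd, show ∀ r : ℝ, r ^ 4 = (r ^ 2) ^ 2 from fun r => by ring,
      Real.sq_sqrt (Real.sqrt_nonneg _), Real.sq_sqrt hB]
  have hdev : ∀ i, |halfDeviation q n ω i| ≤ d := by
    intro i
    refine le_of_pow_le_pow_left₀ (n := 4) (by norm_num) (Real.sqrt_nonneg _) ?_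
    rw [hd4, Even.pow_abs (by decide)]
    exact halfDeviation_pow_four_le q n ω i
  have h := abs_levelDifference_le (u := u) (n := n) (x := fun i => ω (s, a, i)) hβ0 hβ1 (hqβ s a)
    (fun i => hω (s, a, i)) (fun y => hdev ((s, a), y, true)) (fun y => hdev ((s, a), y, false))
    hδ hδβ hU
  rw [← sq_abs]
  calc _ ≤ (300000000 * U * d ^ 2 / (δ * β ^ 3)) ^ 2 := by gcongr
    _ = (300000000 / (δ * β ^ 3)) ^ 2 * U ^ 2 * d ^ 4 := by ring
    _ = _ := by rw [hd4]

variable [MeasurableSpace Y] [DiscreteMeasurableSpace Y]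

lemma measurable_quarticBound (q : S → A → PMF Y) (n : ℕ) : Measurable (quarticBound q n) := by
  have := measurable_halfDeviation q n
  unfold quarticBound
  fun_prop

/-- The expectation of the bound on the largest fourth power at level `n` is of order
`logCount ^ 2 / 4 ^ n`. -/
lemma integral_quarticBound_le [Nonempty S] [Nonempty A] [Nonempty Y] (q : S → A → PMF Y)
    (n : ℕ) :
    Integrable (quarticBound q n) (sampleLaw q) ∧
    ∫ ω, quarticBound q n ω ∂sampleLaw q ≤ 30 * logCount S A Y ^ 2 / 4 ^ n := by
  set L := logCount S A Y with hLdef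
  have hL : 1 ≤ L := one_le_logCount
  have hsL : √L ^ 2 = L := Real.sq_sqrt (by linarith)
  have hexp : ∀ (i : (S × A) × Y × Bool) (t : ℝ), t ^ 2 = 4 * L →
      Integrable (fun ω => Real.exp (t * (√(2 ^ n) * halfDeviation q n ω i) - 3 / 2 * L))
        (sampleLaw q) ∧
      ∫ ω, Real.exp (t * (√(2 ^ n) * halfDeviation q n ω i) - 3 / 2 * L) ∂sampleLaw q
        ≤ Real.exp (-L) := by
    intro i t ht
    obtain ⟨h1, h2⟩ := mgf_halfDeviation q n i t
    simp_rw [Real.exp_sub]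
    refine ⟨h1.div_const _, ?_⟩
    rw [integral_div, div_le_iff₀ (Real.exp_pos _), ← Real.exp_add]
    refine h2.trans (Real.exp_le_exp.2 ?_)
    rw [ht]; linarith
  have ht1 : (2 * √L) ^ 2 = 4 * L := by rw [mul_pow, hsL]; norm_num
  have ht2 : (-(2 * √L)) ^ 2 = 4 * L := by rw [neg_sq, ht1]
  have hint : ∀ i : (S × A) × Y × Bool, Integrable (fun ω =>
      Real.exp (2 * √L * (√(2 ^ n) * halfDeviation q n ω i) - 3 / 2 * L)
      + Real.exp (-(2 * √L) * (√(2 ^ n) * halfDeviation q n ω i) - 3 / 2 * L)) (sampleLaw q) :=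
    fun i => (hexp i _ ht1).1.add (hexp i _ ht2).1
  have hintS := integrable_finsetSum Finset.univ fun i _ => hint i
  unfold quarticBound
  rw [← hLdef]
  refine ⟨((integrable_const _).add (hintS.const_mul 24)).div_const _, ?_⟩
  rw [integral_div, integral_add (integrable_const _) (hintS.const_mul 24),
    integral_const_mul (24 : ℝ), integral_finsetSum _ fun i _ => hint i]
  have hcard : ∑ i : (S × A) × Y × Bool, ∫ ω,
      (Real.exp (2 * √L * (√(2 ^ n) * halfDeviation q n ω i) - 3 / 2 * L)
      + Real.exp (-(2 * √L) * (√(2 ^ n) * halfDeviation q n ω i) - 3 / 2 * L)) ∂sampleLaw q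
      ≤ 1 := by
    calc _ ≤ ∑ i : (S × A) × Y × Bool, 2 * Real.exp (-L) := by
          refine Finset.sum_le_sum fun i _ => ?_
          rw [integral_add (hexp i _ ht1).1 (hexp i _ ht2).1]
          linarith [(hexp i _ ht1).2, (hexp i _ ht2).2]
      _ = 2 * Real.exp (-1) := by
          have hpos : (0 : ℝ) < 2 * (Fintype.card S * Fintype.card A * Fintype.card Y) := by
            have hS : (0 : ℝ) < Fintype.card S := by exact_mod_cast Fintype.card_pos
            have hA : (0 : ℝ) < Fintype.card A := by exact_mod_cast Fintype.card_pos
            have hY : (0 : ℝ) < Fintype.card Y := by exact_mod_cast Fintype.card_pos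
            positivity
          have hE : Real.exp (-L) = Real.exp (-1) /
              (2 * (Fintype.card S * Fintype.card A * Fintype.card Y)) := by
            rw [hLdef, logCount, neg_add, Real.exp_add, Real.exp_neg (Real.log _),
              Real.exp_log hpos]
            rfl
          rw [Finset.sum_const, Finset.card_univ, nsmul_eq_mul, hE]
          simp only [Fintype.card_prod, Fintype.card_bool]
          push_cast
          field_simp
      _ ≤ 1 := by
          have := Real.exp_one_gt_d9
          rw [Real.exp_neg, ← div_eq_mul_inv, div_le_one (by positivity)]
          linarith
  simp only [integral_const, probReal_univ, one_smul]
  gcongr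
  nlinarith

end QuarticBound

/-! ### Random levels -/

section Measurability
variable {Y : Type*} [Fintype Y] [MeasurableSpace Y] [DiscreteMeasurableSpace Y]

lemma measurable_multilevelEstimate (δ g : ℝ) (u : Y → ℝ) :
    Measurable fun z : ℕ × (ℕ → Y) => multilevelEstimate δ g u z.1 z.2 := by
  refine measurable_from_prod_countable_right fun n => ?_
  have hu : Measurable u := Measurable.of_discrete
  exact (hu.comp (measurable_pi_apply 0)).add
    ((measurable_levelDifference δ u n).div_const (g * (1 - g) ^ n))

end Measurability

lemma sq_norm_le_of_forall_sq_le {I : Type*} [Fintype I] {f : I → ℝ} {C : ℝ} (hC : 0 ≤ C)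
    (h : ∀ x, f x ^ 2 ≤ C) : ‖f‖ ^ 2 ≤ C := by
  have h1 : ‖f‖ ≤ √C := (pi_norm_le_iff_of_nonneg (Real.sqrt_nonneg C)).2 fun x => by
    rw [Real.norm_eq_abs]; exact Real.abs_le_sqrt (h x)
  calc ‖f‖ ^ 2 ≤ √C ^ 2 := by gcongr
    _ = C := Real.sq_sqrt hC

lemma hasSum_one_div_geometric {g : ℝ} (hg0 : 0 < g) (hg : g < 3 / 4) :
    HasSum (fun n : ℕ => 1 / (g * (1 - g) ^ n * 4 ^ n)) (4 * (1 - g) / (g * (3 - 4 * g))) := by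
  have h1 : 0 < 1 - g := by linarith
  have h2 : 0 < 3 - 4 * g := by linarith
  have hr : 1 / (4 * (1 - g)) < 1 := by rw [div_lt_one (by linarith)]; linarith
  have h := (hasSum_geometric_of_lt_one (by positivity) hr).mul_left (1 / g)
  have e1 : (fun n : ℕ => 1 / (g * (1 - g) ^ n * 4 ^ n))
      = fun n : ℕ => 1 / g * (1 / (4 * (1 - g))) ^ n := by
    funext n
    rw [div_pow, one_pow, mul_pow]
    field_simp
  have e2 : 4 * (1 - g) / (g * (3 - 4 * g)) = 1 / g * (1 - 1 / (4 * (1 - g)))⁻¹ := by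
    rw [one_sub_div (by positivity), inv_div, show 4 * (1 - g) - 1 = 3 - 4 * g by ring]
    field_simp
  rw [e1, e2]
  exact h

/-- The second moment of a randomized single-term estimator: the squared weight `1 / p_n ^ 2` is
averaged with the probability `p_n`, and second moments of order `4 ^ (-n)` compensate the remaining
factor `1 / p_n`. -/
lemma integral_randomLevel_le {Ω : Type*} [MeasurableSpace Ω] {P : Measure Ω}
    [IsProbabilityMeasure P] {g : unitInterval} (hg0 : 0 < (g : ℝ)) (hg : (g : ℝ) < 3 / 4)
    {f : ℕ → Ω → ℝ} {b : ℝ} (hf0 : ∀ n ω, 0 ≤ f n ω) (hf : ∀ n, Integrable (f n) P)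
    (hfm : ∀ n, Measurable (f n)) (hfb : ∀ n, ∫ ω, f n ω ∂P ≤ b / 4 ^ n) :
    Integrable (fun z : ℕ × Ω => f z.1 z.2 / ((g : ℝ) * (1 - g) ^ z.1) ^ 2)
      ((geometricMeasure g).prod P) ∧
    ∫ z, f z.1 z.2 / ((g : ℝ) * (1 - g) ^ z.1) ^ 2 ∂((geometricMeasure g).prod P)
      ≤ b * (4 * (1 - g) / (g * (3 - 4 * g))) := by
  have hgne : g ≠ 0 := fun h => by rw [h] at hg0; exact lt_irrefl _ hg0
  have h1g : 0 < 1 - (g : ℝ) := by linarith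
  have hp : ∀ n : ℕ, 0 < (g : ℝ) * (1 - g) ^ n := fun n => by positivity
  have hsum := (hasSum_one_div_geometric hg0 hg).mul_left b
  have hle : ∀ n : ℕ, (1 - (g : ℝ)) ^ n * g * ∫ ω, f n ω / ((g : ℝ) * (1 - g) ^ n) ^ 2 ∂P
      ≤ b * (1 / (g * (1 - g) ^ n * 4 ^ n)) := by
    intro n
    rw [integral_div]
    have e : (1 - (g : ℝ)) ^ n * g * ((∫ ω, f n ω ∂P) / ((g : ℝ) * (1 - g) ^ n) ^ 2)
        = (∫ ω, f n ω ∂P) / (g * (1 - g) ^ n) := by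
      field_simp
    rw [e, div_le_iff₀ (hp n)]
    refine (hfb n).trans (le_of_eq ?_)
    field_simp
  have hnn : ∀ n : ℕ, 0 ≤ (1 - (g : ℝ)) ^ n * g *
      ∫ ω, f n ω / ((g : ℝ) * (1 - g) ^ n) ^ 2 ∂P := fun n =>
    mul_nonneg (by positivity) (integral_nonneg fun ω => div_nonneg (hf0 n ω) (sq_nonneg _))
  have hsummable := Summable.of_nonneg_of_le hnn hle hsum.summable
  have hmeas : Measurable fun z : ℕ × Ω => f z.1 z.2 / ((g : ℝ) * (1 - g) ^ z.1) ^ 2 :=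
    measurable_from_prod_countable_right fun n => (hfm n).div_const (((g : ℝ) * (1 - g) ^ n) ^ 2)
  have hnorm : ∀ (n : ℕ) (ω : Ω), ‖f n ω / ((g : ℝ) * (1 - g) ^ n) ^ 2‖
      = f n ω / ((g : ℝ) * (1 - g) ^ n) ^ 2 := fun n ω => by
    rw [Real.norm_of_nonneg (div_nonneg (hf0 n ω) (sq_nonneg _))]
  have hint : Integrable (fun z : ℕ × Ω => f z.1 z.2 / ((g : ℝ) * (1 - g) ^ z.1) ^ 2)
      ((geometricMeasure g).prod P) := by
    rw [integrable_prod_iff hmeas.aestronglyMeasurable]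
    refine ⟨Filter.Eventually.of_forall fun n =>
      (hf n).div_const (((g : ℝ) * (1 - g) ^ n) ^ 2), ?_⟩
    simp_rw [hnorm]
    rw [integrable_geometricMeasure_iff hgne]
    refine hsummable.congr fun n => ?_
    rw [Real.norm_of_nonneg (integral_nonneg fun ω => div_nonneg (hf0 n ω) (sq_nonneg _))]
  refine ⟨hint, ?_⟩
  rw [integral_prod _ hint, integral_geometricMeasure hgne]
  simp only [smul_eq_mul]
  rw [← hsum.tsum_eq]
  exact hsummable.tsum_le_tsum hle hsum.summable

lemma toReal_pos_of_mem_support {Y : Type*} {q : PMF Y} {y : Y} (hy : y ∈ q.support) :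
    0 < (q y).toReal :=
  ENNReal.toReal_pos ((q.mem_support_iff y).1 hy) (q.apply_ne_top y)

lemma iInf_support_pos {Y : Type*} [Finite Y] (q : PMF Y) :
    0 < ⨅ y : q.support, (q y).toReal := by
  have : Nonempty q.support := q.support_nonempty.to_subtype
  obtain ⟨y, hy⟩ := exists_eq_ciInf_of_finite (f := fun y : q.support => (q y).toReal)
  rw [← hy]
  exact toReal_pos_of_mem_support y.2

namespace NominalMDP
variable {S A : Type*} (M : NominalMDP S A)

lemma abs_reward_le_rMax (r : M.R) : |(r : ℝ)| ≤ M.rMax := by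
  rw [abs_of_nonneg (M.R_nonneg r r.2)]
  exact le_csSup M.R.finite_toSet.bddAbove r.2

section Finite
variable [Finite S] [Finite A]

lemma minSupp_le_reward (s : S) (a : A) {r : M.R} (hr : r ∈ (M.ν s a).support) :
    M.minSupp ≤ (M.ν s a r).toReal :=
  (ciInf_le (Set.finite_range _).bddBelow (s, a)).trans ((min_le_left _ _).trans
    (ciInf_le (Set.finite_range fun r : (M.ν s a).support => (M.ν s a r).toReal).bddBelow
      (⟨r, hr⟩ : (M.ν s a).support)))

lemma minSupp_le_state (s : S) (a : A) {s' : S} (hs : s' ∈ (M.p s a).support) :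
    M.minSupp ≤ (M.p s a s').toReal :=
  (ciInf_le (Set.finite_range _).bddBelow (s, a)).trans ((min_le_right _ _).trans
    (ciInf_le (Set.finite_range fun s' : (M.p s a).support => (M.p s a s').toReal).bddBelow
      (⟨s', hs⟩ : (M.p s a).support)))

variable [Nonempty S] [Nonempty A]

lemma minSupp_pos : 0 < M.minSupp := by
  obtain ⟨x, hx⟩ := exists_eq_ciInf_of_finite (f := fun x : S × A =>
    min (⨅ r : (M.ν x.1 x.2).support, (M.ν x.1 x.2 r).toReal)
    (⨅ s : (M.p x.1 x.2).support, (M.p x.1 x.2 s).toReal))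
  rw [minSupp, ← hx]
  exact lt_min (iInf_support_pos _) (iInf_support_pos _)

lemma minSupp_le_one : M.minSupp ≤ 1 := by
  obtain ⟨s⟩ := ‹Nonempty S›
  obtain ⟨a⟩ := ‹Nonempty A›
  obtain ⟨r, hr⟩ := (M.ν s a).support_nonempty
  refine (M.minSupp_le_reward s a hr).trans ?_
  exact ENNReal.toReal_le_of_le_ofReal zero_le_one (by simpa using (M.ν s a).coe_le_one r)

end Finite

end NominalMDP

/-! ### The noise of the estimator -/

lemma abs_greedyValue_le {S A : Type*} [Fintype S] [Fintype A] [Nonempty A] (Q : S × A → ℝ)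
    (s : S) : |greedyValue Q s| ≤ ‖Q‖ := by
  obtain ⟨b, hb⟩ := exists_eq_ciSup_of_finite (f := fun b : A => Q (s, b))
  rw [greedyValue, ← hb]
  exact norm_le_pi_norm Q (s, b)

lemma abs_expect_le {Y : Type*} [Fintype Y] (q : PMF Y) {u : Y → ℝ} {U : ℝ}
    (hU : ∀ y, |u y| ≤ U) : |expect q u| ≤ U := by
  have h1 : ∑ y, (q y).toReal = 1 := by
    have h := q.tsum_coe
    rw [tsum_fintype] at h
    rw [← ENNReal.toReal_sum fun y _ => q.apply_ne_top y, h, ENNReal.toReal_one]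
  calc |expect q u| ≤ ∑ y, |(q y).toReal * u y| := Finset.abs_sum_le_sum_abs _ _
    _ ≤ ∑ y, (q y).toReal * U := Finset.sum_le_sum fun y _ => by
        rw [abs_mul, abs_of_nonneg ENNReal.toReal_nonneg]
        exact mul_le_mul_of_nonneg_left (hU y) ENNReal.toReal_nonneg
    _ = U := by rw [← Finset.sum_mul, h1, one_mul]

lemma self_mem_klBall {Y : Type*} [MeasurableSpace Y] (δ : ℝ) (q : PMF Y) : q ∈ klBall δ q := by
  change InformationTheory.klDiv _ _ ≤ _
  rw [InformationTheory.klDiv_self]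
  exact zero_le

namespace NominalMDP

section Nonempty
variable {S A : Type*} [Nonempty S] [Nonempty A] (M : NominalMDP S A)

lemma nonempty_R : Nonempty M.R := by
  obtain ⟨s⟩ := ‹Nonempty S›
  obtain ⟨a⟩ := ‹Nonempty A›
  obtain ⟨r, -⟩ := (M.ν s a).support_nonempty
  exact ⟨r⟩

lemma rMax_nonneg : 0 ≤ M.rMax := by
  obtain ⟨r⟩ := M.nonempty_R
  exact (abs_nonneg _).trans (M.abs_reward_le_rMax r)

end Nonempty

section Bound
variable {S A : Type*} [Fintype S] [Fintype A] (M : NominalMDP S A)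

/-- A random variable dominating the squared noise at every state-action pair, as a function of the
levels used for that pair and of all samples. -/
def noiseBound (δ g : ℝ) (Q : S × A → ℝ)
    (z : (ℕ × ℕ) × ((S × A × ℕ → M.R) × (S × A × ℕ → S))) : ℝ :=
  24 * (M.rMax ^ 2 + M.γ ^ 2 * ‖Q‖ ^ 2)
    + 3 * ((300000000 / (δ * M.minSupp ^ 3)) ^ 2 * M.rMax ^ 2) *
      (quarticBound M.ν z.1.1 z.2.1 / (g * (1 - g) ^ z.1.1) ^ 2)
    + 3 * ((300000000 / (δ * M.minSupp ^ 3)) ^ 2 * (M.γ ^ 2 * ‖Q‖ ^ 2)) *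
      (quarticBound M.p z.1.2 z.2.2 / (g * (1 - g) ^ z.1.2) ^ 2)

lemma noiseBound_nonneg (δ g : ℝ) (Q : S × A → ℝ)
    (z : (ℕ × ℕ) × ((S × A × ℕ → M.R) × (S × A × ℕ → S))) : 0 ≤ M.noiseBound δ g Q z := by
  have h1 := quarticBound_nonneg M.ν z.1.1 z.2.1
  have h2 := quarticBound_nonneg M.p z.1.2 z.2.2
  unfold noiseBound
  positivity

variable [MeasurableSpace S]

lemma abs_robustBellman_le [Nonempty A] (δ : ℝ) (Q : S × A → ℝ) (x : S × A) :
    |M.robustBellman δ Q x| ≤ M.rMax + M.γ * ‖Q‖ := by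
  have hbound : ∀ t ∈ {t : ℝ | ∃ ν' ∈ klBall δ (M.ν x.1 x.2), ∃ p' ∈ klBall δ (M.p x.1 x.2),
      t = expect ν' (fun r => (r : ℝ)) + M.γ * expect p' (greedyValue Q)},
      |t| ≤ M.rMax + M.γ * ‖Q‖ := by
    rintro t ⟨ν', -, p', -, rfl⟩
    refine (abs_add_le _ _).trans (add_le_add (abs_expect_le _ M.abs_reward_le_rMax) ?_)
    rw [abs_mul, abs_of_pos M.γ_pos]
    exact mul_le_mul_of_nonneg_left (abs_expect_le _ (abs_greedyValue_le Q)) M.γ_pos.le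
  have hne : {t : ℝ | ∃ ν' ∈ klBall δ (M.ν x.1 x.2), ∃ p' ∈ klBall δ (M.p x.1 x.2),
      t = expect ν' (fun r => (r : ℝ)) + M.γ * expect p' (greedyValue Q)}.Nonempty :=
    ⟨_, _, self_mem_klBall δ _, _, self_mem_klBall δ _, rfl⟩
  rw [robustBellman, abs_le]
  obtain ⟨t, ht⟩ := hne
  exact ⟨le_csInf ⟨t, ht⟩ fun t ht => (abs_le.1 (hbound t ht)).1,
    (csInf_le ⟨_, fun t ht => (abs_le.1 (hbound t ht)).1⟩ ht).trans (abs_le.1 (hbound t ht)).2⟩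

end Bound

lemma measurable_noise {S A : Type*} [Fintype S] [MeasurableSpace S]
    [DiscreteMeasurableSpace S] (M : NominalMDP S A) (δ g : ℝ) (Q : S × A → ℝ) :
    Measurable (M.noise δ g Q) := by
  refine measurable_pi_lambda _ fun x => Measurable.sub_const ?_ _
  have h1 : Measurable fun ω : Variates M =>
      ((ω.1 x).1, fun i : ℕ => ω.2.1 (x.1, x.2, i)) := by fun_prop
  have h2 : Measurable fun ω : Variates M =>
      ((ω.1 x).2, fun i : ℕ => ω.2.2 (x.1, x.2, i)) := by fun_prop
  exact ((measurable_multilevelEstimate δ g fun r : M.R => (r : ℝ)).comp h1).add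
    (((measurable_multilevelEstimate δ g (greedyValue Q)).comp h2).const_mul M.γ)

section Level
variable {S A : Type*} [Fintype S] [Nonempty S] [Fintype A] [Nonempty A] (M : NominalMDP S A)

lemma one_le_entropyFactor :
    1 ≤ 3 + max (Real.log (Fintype.card S * Fintype.card A * M.R.card))
      (Real.log ((Fintype.card S : ℝ) ^ 2 * Fintype.card A)) := by
  have hS : (1 : ℝ) ≤ Fintype.card S := by exact_mod_cast Fintype.card_pos
  have hA : (1 : ℝ) ≤ Fintype.card A := by exact_mod_cast Fintype.card_pos
  have h : 0 ≤ Real.log ((Fintype.card S : ℝ) ^ 2 * Fintype.card A) :=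
    Real.log_nonneg (one_le_mul_of_one_le_of_one_le (one_le_pow₀ hS) hA)
  have := h.trans (le_max_right (Real.log (Fintype.card S * Fintype.card A * M.R.card)) _)
  linarith

lemma logCount_reward_le :
    logCount S A M.R ≤ 3 + max (Real.log (Fintype.card S * Fintype.card A * M.R.card))
      (Real.log ((Fintype.card S : ℝ) ^ 2 * Fintype.card A)) := by
  have := M.nonempty_R
  have hS : (0 : ℝ) < Fintype.card S := by exact_mod_cast Fintype.card_pos
  have hA : (0 : ℝ) < Fintype.card A := by exact_mod_cast Fintype.card_pos
  have hR : (0 : ℝ) < M.R.card := by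
    rw [← Fintype.card_coe]; exact_mod_cast Fintype.card_pos
  refine (logCount_le (x := Fintype.card S * Fintype.card A * M.R.card) (by positivity)
    (by rw [Fintype.card_coe])).trans ?_
  gcongr
  exact le_max_left _ _

lemma logCount_state_le :
    logCount S A S ≤ 3 + max (Real.log (Fintype.card S * Fintype.card A * M.R.card))
      (Real.log ((Fintype.card S : ℝ) ^ 2 * Fintype.card A)) := by
  have hS : (0 : ℝ) < Fintype.card S := by exact_mod_cast Fintype.card_pos
  have hA : (0 : ℝ) < Fintype.card A := by exact_mod_cast Fintype.card_pos
  refine (logCount_le (x := (Fintype.card S : ℝ) ^ 2 * Fintype.card A) (by positivity)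
    (by ring)).trans ?_
  gcongr
  exact le_max_right _ _

variable [MeasurableSpace S]

lemma sq_noise_le {δ g : ℝ} (hδ : 0 < δ) (hδβ : 1 - Real.exp (-δ) ≤ 1 / 2 * M.minSupp)
    (Q : S × A → ℝ) {ω : Variates M}
    (h1 : ∀ k, ω.2.1 k ∈ (M.ν k.1 k.2.1).support) (h2 : ∀ k, ω.2.2 k ∈ (M.p k.1 k.2.1).support)
    (x : S × A) : M.noise δ g Q ω x ^ 2 ≤ M.noiseBound δ g Q (ω.1 x, ω.2) := by
  have hΔ1 := sq_levelDifference_le (u := fun r : M.R => (r : ℝ)) M.minSupp_pos M.minSupp_le_one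
    (fun s a y hy => M.minSupp_le_reward s a hy) hδ hδβ M.abs_reward_le_rMax h1 (ω.1 x).1 x.1 x.2
  have hΔ2 := sq_levelDifference_le (u := greedyValue Q) M.minSupp_pos M.minSupp_le_one
    (fun s a y hy => M.minSupp_le_state s a hy) hδ hδβ (abs_greedyValue_le Q) h2 (ω.1 x).2 x.1 x.2
  have hT := M.abs_robustBellman_le δ Q x
  have hr := M.abs_reward_le_rMax (ω.2.1 (x.1, x.2, 0))
  have hv := abs_greedyValue_le Q (ω.2.2 (x.1, x.2, 0))
  have hB := M.rMax_nonneg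
  have hG : 0 ≤ M.γ * ‖Q‖ := mul_nonneg M.γ_pos.le (norm_nonneg _)
  have hγv : |M.γ * greedyValue Q (ω.2.2 (x.1, x.2, 0))| ≤ M.γ * ‖Q‖ := by
    rw [abs_mul, abs_of_pos M.γ_pos]
    exact mul_le_mul_of_nonneg_left hv M.γ_pos.le
  set D1 := levelDifference δ (fun r : M.R => (r : ℝ)) (ω.1 x).1 fun i => ω.2.1 (x.1, x.2, i)
  set D2 := levelDifference δ (greedyValue Q) (ω.1 x).2 fun i => ω.2.2 (x.1, x.2, i)
  set w1 := g * (1 - g) ^ (ω.1 x).1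
  set w2 := g * (1 - g) ^ (ω.1 x).2
  set K := (300000000 / (δ * M.minSupp ^ 3)) ^ 2
  have hnoise : M.noise δ g Q ω x = (ω.2.1 (x.1, x.2, 0) +
      M.γ * greedyValue Q (ω.2.2 (x.1, x.2, 0)) - M.robustBellman δ Q x) + D1 / w1
      + M.γ * (D2 / w2) := by
    simp only [noise, mlmcEstimator, multilevelEstimate]
    ring
  set c := (ω.2.1 (x.1, x.2, 0) : ℝ) +
      M.γ * greedyValue Q (ω.2.2 (x.1, x.2, 0)) - M.robustBellman δ Q x
  have hc : c ^ 2 ≤ 8 * (M.rMax ^ 2 + (M.γ * ‖Q‖) ^ 2) := by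
    have : |c| ≤ 2 * (M.rMax + M.γ * ‖Q‖) := by
      refine (abs_sub _ _).trans ?_
      have := abs_add_le (ω.2.1 (x.1, x.2, 0) : ℝ) (M.γ * greedyValue Q (ω.2.2 (x.1, x.2, 0)))
      linarith
    have h := pow_le_pow_left₀ (abs_nonneg c) this 2
    rw [sq_abs] at h
    nlinarith [sq_nonneg (M.rMax - M.γ * ‖Q‖)]
  have e1 : (D1 / w1) ^ 2 ≤ K * M.rMax ^ 2 * (quarticBound M.ν (ω.1 x).1 ω.2.1 / w1 ^ 2) := by
    rw [div_pow, ← mul_div_assoc]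
    gcongr
  have e2 : (M.γ * (D2 / w2)) ^ 2
      ≤ K * (M.γ ^ 2 * ‖Q‖ ^ 2) * (quarticBound M.p (ω.1 x).2 ω.2.2 / w2 ^ 2) := by
    calc (M.γ * (D2 / w2)) ^ 2 = M.γ ^ 2 * (D2 ^ 2 / w2 ^ 2) := by ring
      _ ≤ M.γ ^ 2 * ((K * ‖Q‖ ^ 2 * quarticBound M.p (ω.1 x).2 ω.2.2) / w2 ^ 2) := by gcongr
      _ = _ := by ring
  have e3 : (c + D1 / w1 + M.γ * (D2 / w2)) ^ 2
      ≤ 3 * (c ^ 2 + (D1 / w1) ^ 2 + (M.γ * (D2 / w2)) ^ 2) := by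
    nlinarith [sq_nonneg (c - D1 / w1), sq_nonneg (c - M.γ * (D2 / w2)),
      sq_nonneg (D1 / w1 - M.γ * (D2 / w2))]
  rw [hnoise, noiseBound]
  rw [mul_pow] at hc
  change _ ≤ 24 * (M.rMax ^ 2 + M.γ ^ 2 * ‖Q‖ ^ 2)
    + 3 * (K * M.rMax ^ 2) * (quarticBound M.ν (ω.1 x).1 ω.2.1 / w1 ^ 2)
    + 3 * (K * (M.γ ^ 2 * ‖Q‖ ^ 2)) * (quarticBound M.p (ω.1 x).2 ω.2.2 / w2 ^ 2)
  linarith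

variable [DiscreteMeasurableSpace S]

/-- The expectation of the dominating variable, for any law of the levels whose marginal at the
pair `x` is that of two independent geometric levels. -/
lemma integral_noiseBound_le {L : Measure (S × A → ℕ × ℕ)} [IsProbabilityMeasure L]
    {δ : ℝ} {g : unitInterval} (hg0 : 0 < (g : ℝ)) (hg : (g : ℝ) < 3 / 4) (hδ : 0 < δ)
    (hδβ : 1 - Real.exp (-δ) ≤ 1 / 2 * M.minSupp) (Q : S × A → ℝ) (x : S × A)
    (hL : MeasurePreserving (fun n : S × A → ℕ × ℕ => n x) L
      ((geometricMeasure g).prod (geometricMeasure g))) :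
    Integrable (fun ω : Variates M => M.noiseBound δ g Q (ω.1 x, ω.2)) (M.variatesLaw L) ∧
    ∫ ω, M.noiseBound δ g Q (ω.1 x, ω.2) ∂(M.variatesLaw L) ≤
      10 ^ 19 * M.logFactor g / (δ ^ 4 * M.minSupp ^ 6) * (M.rMax ^ 2 + M.γ ^ 2 * ‖Q‖ ^ 2) := by
  have := M.nonempty_R
  have hβ0 := M.minSupp_pos
  have hβ1 := M.minSupp_le_one
  have hδ1 : δ ≤ 1 := (radius_le_of_one_sub_exp_le hβ0 hβ1 hδβ).trans hβ1
  have hp1 : MeasurePreserving (fun ω : Variates M => ((ω.1 x).1, ω.2.1)) (M.variatesLaw L)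
      ((geometricMeasure g).prod (sampleLaw M.ν)) :=
    (measurePreserving_fst.comp hL).prod measurePreserving_fst
  have hp2 : MeasurePreserving (fun ω : Variates M => ((ω.1 x).2, ω.2.2)) (M.variatesLaw L)
      ((geometricMeasure g).prod (sampleLaw M.p)) :=
    (measurePreserving_snd.comp hL).prod measurePreserving_snd
  have : IsProbabilityMeasure (M.variatesLaw L) := by unfold variatesLaw; infer_instance
  obtain ⟨i1, b1⟩ := integral_randomLevel_le (P := sampleLaw M.ν) hg0 hg
    (quarticBound_nonneg M.ν) (fun n => (integral_quarticBound_le M.ν n).1)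
    (measurable_quarticBound M.ν) (fun n => (integral_quarticBound_le M.ν n).2)
  obtain ⟨i2, b2⟩ := integral_randomLevel_le (P := sampleLaw M.p) hg0 hg
    (quarticBound_nonneg M.p) (fun n => (integral_quarticBound_le M.p n).1)
    (measurable_quarticBound M.p) (fun n => (integral_quarticBound_le M.p n).2)
  have j1 := hp1.integrable_comp_of_integrable i1
  have j2 := hp2.integrable_comp_of_integrable i2
  rw [← hp1.map_eq, integral_map hp1.aemeasurable
    (by rw [hp1.map_eq]; exact i1.aestronglyMeasurable)] at b1
  rw [← hp2.map_eq, integral_map hp2.aemeasurable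
    (by rw [hp2.map_eq]; exact i2.aestronglyMeasurable)] at b2
  simp only [Function.comp_def] at j1 j2
  set K := (300000000 / (δ * M.minSupp ^ 3)) ^ 2 with hK
  set B := M.rMax ^ 2
  set G := M.γ ^ 2 * ‖Q‖ ^ 2
  have hB : 0 ≤ B := sq_nonneg _
  have hG : 0 ≤ G := mul_nonneg (sq_nonneg _) (sq_nonneg _)
  have k1 := j1.const_mul (3 * (K * B))
  have k2 := j2.const_mul (3 * (K * G))
  have k0 := integrable_const (μ := M.variatesLaw L) (24 * (B + G))
  have k01 : Integrable (fun ω : Variates M => 24 * (B + G) + 3 * (K * B) *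
      (quarticBound M.ν (ω.1 x).1 ω.2.1 / ((g : ℝ) * (1 - g) ^ (ω.1 x).1) ^ 2))
      (M.variatesLaw L) := k0.add k1
  have e := integral_add k01 k2
  rw [integral_add k0 k1, integral_const_mul (3 * (K * B)), integral_const_mul (3 * (K * G)),
    integral_const, probReal_univ,
    one_smul] at e
  refine ⟨k01.add k2, e.le.trans ?_⟩
  set Γ := 4 * (1 - (g : ℝ)) / (g * (3 - 4 * g)) with hΓ
  set Λ := 3 + max (Real.log (Fintype.card S * Fintype.card A * M.R.card))
      (Real.log ((Fintype.card S : ℝ) ^ 2 * Fintype.card A)) with hΛ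
  have hΛ1 : 1 ≤ Λ := M.one_le_entropyFactor
  have hΓ1 : 1 ≤ Γ := by
    rw [hΓ, one_le_div (mul_pos hg0 (by linarith))]
    nlinarith
  have hlog : 1 ≤ Real.log (11 / M.minSupp) := by
    rw [Real.le_log_iff_exp_le (by positivity), le_div_iff₀ hβ0]
    have := Real.exp_one_lt_d9
    have := Real.exp_pos 1
    nlinarith
  have hF : Λ ^ 2 * Γ ≤ M.logFactor g := by
    change Λ ^ 2 * Γ ≤ Λ ^ 2 * Real.log (11 / M.minSupp) ^ 2 * Γ
    have : 1 ≤ Real.log (11 / M.minSupp) ^ 2 := one_le_pow₀ hlog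
    gcongr
    nlinarith [sq_nonneg Λ]
  have hD : 0 < δ ^ 4 * M.minSupp ^ 6 := by positivity
  have hD1 : δ ^ 4 * M.minSupp ^ 6 ≤ 1 :=
    mul_le_one₀ (pow_le_one₀ hδ.le hδ1) (by positivity) (pow_le_one₀ hβ0.le hβ1)
  have hKD : K ≤ 300000000 ^ 2 / (δ ^ 4 * M.minSupp ^ 6) := by
    rw [hK, div_pow, mul_pow, ← pow_mul]
    have : δ ^ 4 ≤ δ ^ 2 := pow_le_pow_of_le_one hδ.le hδ1 (by norm_num)
    gcongr
  have hΛΓ : 1 ≤ Λ ^ 2 * Γ := one_le_mul_of_one_le_of_one_le (one_le_pow₀ hΛ1) hΓ1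
  have hL1 : (1 : ℝ) ≤ logCount S A M.R := one_le_logCount
  have hL2 : (1 : ℝ) ≤ logCount S A S := one_le_logCount
  have t : ∀ V l I : ℝ, 0 ≤ V → 1 ≤ l → l ≤ Λ → I ≤ 30 * l ^ 2 * Γ → 3 * (K * V) * I
      ≤ 90 * 300000000 ^ 2 * V * (Λ ^ 2 * Γ / (δ ^ 4 * M.minSupp ^ 6)) := by
    intro V l I hV hl hlΛ hI
    calc 3 * (K * V) * I
        ≤ 3 * (300000000 ^ 2 / (δ ^ 4 * M.minSupp ^ 6) * V) * (30 * Λ ^ 2 * Γ) := by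
          refine (mul_le_mul_of_nonneg_left hI (by positivity)).trans ?_
          gcongr
      _ = _ := by ring
  have t1 := t B _ _ hB hL1 M.logCount_reward_le b1
  have t2 := t G _ _ hG hL2 M.logCount_state_le b2
  have t0 : 24 * (B + G) ≤ 24 * (B + G) * (Λ ^ 2 * Γ / (δ ^ 4 * M.minSupp ^ 6)) := by
    refine le_mul_of_one_le_right (by positivity) ?_
    rw [one_le_div hD]
    linarith
  have hBG : 0 ≤ B + G := add_nonneg hB hG
  calc _ ≤ (24 + 90 * 300000000 ^ 2) * (B + G) * (Λ ^ 2 * Γ / (δ ^ 4 * M.minSupp ^ 6)) := by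
        linarith
    _ ≤ 10 ^ 19 * (B + G) * (M.logFactor g / (δ ^ 4 * M.minSupp ^ 6)) := by
        gcongr
        norm_num
    _ = _ := by ring

lemma ae_sq_noise_le {L : Measure (S × A → ℕ × ℕ)} [IsProbabilityMeasure L] {δ g : ℝ}
    (hδ : 0 < δ) (hδβ : 1 - Real.exp (-δ) ≤ 1 / 2 * M.minSupp) (Q : S × A → ℝ) :
    ∀ᵐ ω ∂(M.variatesLaw L), ∀ x, M.noise δ g Q ω x ^ 2 ≤ M.noiseBound δ g Q (ω.1 x, ω.2) := by
  have h1 : ∀ᵐ ω ∂(M.variatesLaw L), ∀ k, ω.2.1 k ∈ (M.ν k.1 k.2.1).support :=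
    Measure.quasiMeasurePreserving_snd.ae
      (Measure.quasiMeasurePreserving_fst.ae (ae_mem_support M.ν))
  have h2 : ∀ᵐ ω ∂(M.variatesLaw L), ∀ k, ω.2.2 k ∈ (M.p k.1 k.2.1).support :=
    Measure.quasiMeasurePreserving_snd.ae
      (Measure.quasiMeasurePreserving_snd.ae (ae_mem_support M.p))
  filter_upwards [h1, h2] with ω hω1 hω2 x using M.sq_noise_le hδ hδβ Q hω1 hω2 x

end Level

lemma integral_sq_norm_noise_le {S A : Type*} [Fintype S] [Fintype A] [MeasurableSpace S]
    [DiscreteMeasurableSpace S] (M : NominalMDP S A) {L : Measure (S × A → ℕ × ℕ)} {δ g : ℝ}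
    {Q : S × A → ℝ} {H : Variates M → ℝ} (hH : Integrable H (M.variatesLaw L))
    (h : ∀ᵐ ω ∂(M.variatesLaw L), ‖M.noise δ g Q ω‖ ^ 2 ≤ H ω) :
    Integrable (fun ω => ‖M.noise δ g Q ω‖ ^ 2) (M.variatesLaw L) ∧
    ∫ ω, ‖M.noise δ g Q ω‖ ^ 2 ∂(M.variatesLaw L) ≤ ∫ ω, H ω ∂(M.variatesLaw L) := by
  have hint : Integrable (fun ω => ‖M.noise δ g Q ω‖ ^ 2) (M.variatesLaw L) := by
    refine hH.mono' ((M.measurable_noise δ g Q).norm.pow_const 2).aestronglyMeasurable ?_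
    filter_upwards [h] with ω hω
    rwa [Real.norm_of_nonneg (sq_nonneg _)]
  exact ⟨hint, integral_mono_ae hint hH h⟩

end NominalMDP

lemma measurable_function_const (I : Type*) {X : Type*} [MeasurableSpace X] :
    Measurable fun (z : X) (_ : I) => z :=
  measurable_pi_lambda _ fun _ => measurable_id

instance isProbabilityMeasure_commonLevels (I : Type*) (g : unitInterval) :
    IsProbabilityMeasure (commonLevels I g) :=
  Measure.isProbabilityMeasure_map (measurable_function_const I).aemeasurable

instance isProbabilityMeasure_separateLevels (I : Type*) [Fintype I] (g : unitInterval) :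
    IsProbabilityMeasure (separateLevels I g) := by
  unfold separateLevels; infer_instance

lemma measurePreserving_eval_commonLevels {I : Type*} (g : unitInterval) (x : I) :
    MeasurePreserving (fun n : I → ℕ × ℕ => n x) (commonLevels I g)
      ((geometricMeasure g).prod (geometricMeasure g)) := by
  refine ⟨measurable_pi_apply x, ?_⟩
  rw [commonLevels, Measure.map_map (measurable_pi_apply x) (measurable_function_const I)]
  exact Measure.map_id

lemma ae_commonLevels_eq {I : Type*} [Finite I] (g : unitInterval) (x₀ : I) :
    ∀ᵐ n ∂(commonLevels I g), ∀ x, n x = n x₀ := by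
  rw [commonLevels, ae_map_iff (measurable_function_const I).aemeasurable]
  · exact Filter.Eventually.of_forall fun _ _ => rfl
  · exact MeasurableSet.of_discrete

end

theorem mainTheorem3 :
    ∃ c : ℝ, 0 < c ∧
      ∀ (S A : Type*) [Fintype S] [Nonempty S] [MeasurableSpace S] [DiscreteMeasurableSpace S]
        [Fintype A] [Nonempty A] (M : NominalMDP S A) (δ : ℝ) (g : unitInterval)
        (Q : S × A → ℝ),
        0 < δ → 1 - Real.exp (-δ) ≤ 1 / 2 * M.minSupp →
        0 < (g : ℝ) → (g : ℝ) < 3 / 4 →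
        (Integrable (fun ω => ‖M.noise δ g Q ω‖ ^ 2)
            (M.variatesLaw (commonLevels (S × A) g)) ∧
          ∫ ω, ‖M.noise δ g Q ω‖ ^ 2 ∂(M.variatesLaw (commonLevels (S × A) g)) ≤
            c * M.logFactor g / (δ ^ 4 * M.minSupp ^ 6) *
              (M.rMax ^ 2 + M.γ ^ 2 * ‖Q‖ ^ 2)) ∧
        (Integrable (fun ω => ‖M.noise δ g Q ω‖ ^ 2)
            (M.variatesLaw (separateLevels (S × A) g)) ∧
          ∫ ω, ‖M.noise δ g Q ω‖ ^ 2 ∂(M.variatesLaw (separateLevels (S × A) g)) ≤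
            (c * (Fintype.card S * Fintype.card A)) * M.logFactor g /
                (δ ^ 4 * M.minSupp ^ 6) *
              (M.rMax ^ 2 + M.γ ^ 2 * ‖Q‖ ^ 2)) := by
  -- the constant of `NominalMDP.integral_noiseBound_le`
  refine ⟨10 ^ 19, by positivity, ?_⟩
  intro S A _ _ _ _ _ _ M δ g Q hδ hδβ hg0 hg
  have hcommon := fun x => M.integral_noiseBound_le hg0 hg hδ hδβ Q x
    (measurePreserving_eval_commonLevels g x)
  have hseparate := fun x => M.integral_noiseBound_le (L := separateLevels (S × A) g) hg0 hg hδ hδβ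
    Q x (measurePreserving_eval _ x)
  constructor
  · obtain ⟨x₀⟩ : Nonempty (S × A) := inferInstance
    obtain ⟨hi, hb⟩ := hcommon x₀
    have hae : ∀ᵐ ω ∂(M.variatesLaw (commonLevels (S × A) g)),
        ‖M.noise δ g Q ω‖ ^ 2 ≤ M.noiseBound δ g Q (ω.1 x₀, ω.2) := by
      have h1 : ∀ᵐ ω ∂(M.variatesLaw (commonLevels (S × A) g)), ∀ x, ω.1 x = ω.1 x₀ :=
        Measure.quasiMeasurePreserving_fst.ae (ae_commonLevels_eq g x₀)
      filter_upwards [h1, M.ae_sq_noise_le hδ hδβ Q] with ω hω h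
      refine sq_norm_le_of_forall_sq_le (M.noiseBound_nonneg _ _ _ _) fun x => ?_
      rw [← hω x]
      exact h x
    obtain ⟨h1, h2⟩ := M.integral_sq_norm_noise_le hi hae
    exact ⟨h1, h2.trans hb⟩
  · have hae : ∀ᵐ ω ∂(M.variatesLaw (separateLevels (S × A) g)),
        ‖M.noise δ g Q ω‖ ^ 2 ≤ ∑ x, M.noiseBound δ g Q (ω.1 x, ω.2) := by
      filter_upwards [M.ae_sq_noise_le hδ hδβ Q] with ω h
      refine sq_norm_le_of_forall_sq_le
        (Finset.sum_nonneg fun x _ => M.noiseBound_nonneg _ _ _ _) fun x => (h x).trans ?_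
      exact Finset.single_le_sum (f := fun x => M.noiseBound δ g Q (ω.1 x, ω.2))
        (fun x _ => M.noiseBound_nonneg _ _ _ _) (Finset.mem_univ x)
    obtain ⟨h1, h2⟩ := M.integral_sq_norm_noise_le
      (integrable_finsetSum Finset.univ fun x _ => (hseparate x).1) hae
    refine ⟨h1, h2.trans ?_⟩
    rw [integral_finsetSum _ fun x _ => (hseparate x).1]
    refine (Finset.sum_le_card_nsmul _ _ _ fun x _ => (hseparate x).2).trans (le_of_eq ?_)
    rw [Finset.card_univ, Fintype.card_prod, nsmul_eq_mul]
    push_cast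
    ring
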